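/- Let $\Bbbk$ be an algebraically closed field of characteristic $0$, let $H$ be a finite-dimensional Hopf algebra over $\Bbbk$ with comultiplication $\Delta$ and counit $\varepsilon$, and let $R$ and $S$ be finite-dimensional left $H$-comodule algebras, that is, $\Bbbk$-algebras with a coassociative and counital left $H$-coaction $r\mapsto r_{-1}\otimes r_0$ that is a morphism of algebras. Let ${}_R\mathcal M$ and ${}_S\mathcal M$ be the categories of finite-dimensional left modules, regarded as module categories over the monoidal category $\operatorname{Rep}H$ of finite-dimensional $H$-modules by $X\otimes V:=X\otimes_{\Bbbk}V$ with $r\cdot(x\otimes v)=r_{-1}x\otimes r_0v$. A module functor $(F,c)\colon{}_R\mathcal M\to{}_S\mathcal M$ is a $\Bbbk$-linear functor $F$ with a natural isomorphism $c_{X,V}\colon F(X\otimes V)\to X\otimes F(V)$ compatible with the associativity and unit isomorphisms of the module categories; a morphism $(F,c)\to(G,d)$ is a natural transformation $\alpha$ with $d_{X,V}\,\alpha_{X\otimes V}=(\mathrm{id}_X\otimes\alpha_V)\,c_{X,V}$. It is an equivalence of module categories if there is a module functor $G\colon{}_S\mathcal M\to{}_R\mathcal M$ such that $G\circ F$ and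 $F\circ G$ are isomorphic, as module functors, to the identities. An equivariant $(S,R)$-bimodule is a finite-dimensional $(S,R)$-bimodule $P$ with a (coassociative, counital) left $H$-coaction such that $(s p r)_{-1}\otimes(s p r)_0=s_{-1}p_{-1}r_{-1}\otimes s_0p_0r_0$. An equivariant Morita context for $R$ and $S$ consists of an equivariant $(S,R)$-bimodule $P$, a finite-dimensional $(R,S)$-bimodule $Q$, and bimodule isomorphisms $f\colon P\otimes_RQ\to S$ and $g\colon Q\otimes_SP\to R$ with $f(p\otimes q)p'=p\,g(q\otimes p')$ and $g(q\otimes p)q'=q\,f(p\otimes q')$ for all $p,p'\in P$, $q,q'\in Q$. Two such contexts are isomorphic if there are an isomorphism $P\cong P'$ of equivariant bimodules and an isomorphism $Q\cong Q'$ of bimodules compatible with $f,f'$ and $g,g'$. Then: (1) The assignment $(P,Q,f,g)\mapsto P\otimes_R-$, with $c_{X,V}(p\otimes x\otimes v)=p_{-1}x\otimes p_0\otimes v$, sends every equivariant Morita context for $R$ and $S$ to an equivalence of module categories ${}_R\mathcal M\to{}_S\mathcal M$, and it induces a bijection from isomorphism classes of equivariant Morita contexts for $R$ and $S$ onto isomorphism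 classes (as module functors) of equivalences of module categories ${}_R\mathcal M\to{}_S\mathcal M$. (2) For every equivariant Morita context $(P,Q,f,g)$ there is exactly one left $H$-coaction on $Q$ that makes $Q$ an equivariant $(R,S)$-bimodule for which $f$ and $g$ are morphisms of $H$-comodules, i.e. $f(p\otimes q)_{-1}\otimes f(p\otimes q)_0=p_{-1}q_{-1}\otimes f(p_0\otimes q_0)$ and $g(q\otimes p)_{-1}\otimes g(q\otimes p)_0=q_{-1}p_{-1}\otimes g(q_0\otimes p_0)$. -/

import Mathlib

universe u

open CategoryTheory TensorProduct MonoidalCategory MulOpposite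

namespace HopfModCat

noncomputable section

/-! ### Bilinear maps on tensor products -/

section Bilinear

variable {k M M' N N' Q Q' : Type*} [CommSemiring k]
  [AddCommMonoid M] [AddCommMonoid M'] [AddCommMonoid N] [AddCommMonoid N']
  [AddCommMonoid Q] [AddCommMonoid Q'] [Module k M] [Module k M'] [Module k N] [Module k N']
  [Module k Q] [Module k Q']

/-- The tensor product of two bilinear maps: `(m ⊗ m', n ⊗ n') ↦ f m n ⊗ g m' n'`. -/
def tensorBilin (f : M →ₗ[k] N →ₗ[k] Q) (g : M' →ₗ[k] N' →ₗ[k] Q') :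
    M ⊗[k] M' →ₗ[k] N ⊗[k] N' →ₗ[k] Q ⊗[k] Q' :=
  TensorProduct.homTensorHomMap (.id k) N N' Q Q' ∘ₗ TensorProduct.map f g

@[simp]
theorem tensorBilin_tmul (f : M →ₗ[k] N →ₗ[k] Q) (g : M' →ₗ[k] N' →ₗ[k] Q')
    (m : M) (m' : M') (n : N) (n' : N') :
    tensorBilin f g (m ⊗ₜ m') (n ⊗ₜ n') = f m n ⊗ₜ g m' n' := rfl

end Bilinear

/-! ### Finite-dimensional modules over an algebra -/

/-- A finite-dimensional left module over the `k`-algebra `A`. -/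
structure FDMod (k A : Type u) [Field k] [Ring A] [Algebra k A] where
  carrier : Type u
  [addCommGroup : AddCommGroup carrier]
  [baseModule : Module k carrier]
  [module : Module A carrier]
  [isScalarTower : IsScalarTower k A carrier]
  [finite : FiniteDimensional k carrier]

namespace FDMod

variable {k A : Type u} [Field k] [Ring A] [Algebra k A]

instance : CoeSort (FDMod k A) (Type u) := ⟨FDMod.carrier⟩

attribute [instance] addCommGroup baseModule module isScalarTower finite

instance (M : FDMod k A) : SMulCommClass A k M := IsScalarTower.to_smulCommClass'

/-- Morphisms are the `A`-linear maps. -/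
@[ext]
structure Hom (M N : FDMod k A) where
  lin : M →ₗ[A] N

instance : Category (FDMod k A) where
  Hom M N := Hom M N
  id M := ⟨LinearMap.id⟩
  comp f g := ⟨g.lin ∘ₗ f.lin⟩

/-- The linear map underlying a morphism. -/
def lin {M N : FDMod k A} (f : M ⟶ N) : M →ₗ[A] N := Hom.lin f

/-- An `A`-linear map as a morphism. -/
def ofLin {M N : FDMod k A} (f : M →ₗ[A] N) : M ⟶ N := Hom.mk f

@[simp] theorem lin_ofLin {M N : FDMod k A} (f : M →ₗ[A] N) : lin (ofLin f) = f := rfl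
@[simp] theorem ofLin_lin {M N : FDMod k A} (f : M ⟶ N) : ofLin (lin f) = f := rfl
@[simp] theorem lin_id (M : FDMod k A) : lin (𝟙 M) = LinearMap.id := rfl
@[simp] theorem lin_comp {M N L : FDMod k A} (f : M ⟶ N) (g : N ⟶ L) :
    lin (f ≫ g) = lin g ∘ₗ lin f := rfl

theorem hom_ext {M N : FDMod k A} {f g : M ⟶ N} (h : ∀ m, lin f m = lin g m) : f = g :=
  Hom.ext (LinearMap.ext h)

/-- Morphisms are the same as `A`-linear maps. -/
def homEquiv (M N : FDMod k A) : (M ⟶ N) ≃ (M →ₗ[A] N) := ⟨lin, ofLin, fun _ => rfl, fun _ => rfl⟩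

instance (M N : FDMod k A) : AddCommGroup (M ⟶ N) := (homEquiv M N).addCommGroup

instance (M N : FDMod k A) : Module k (M ⟶ N) := (homEquiv M N).module k

@[simp] theorem lin_add {M N : FDMod k A} (f g : M ⟶ N) : lin (f + g) = lin f + lin g := rfl
@[simp] theorem lin_smul {M N : FDMod k A} (c : k) (f : M ⟶ N) : lin (c • f) = c • lin f := rfl

instance : Preadditive (FDMod k A) where
  add_comp _ _ _ f g h := hom_ext fun m => by simp
  comp_add _ _ _ f g h := hom_ext fun m => by simp

instance : CategoryTheory.Linear k (FDMod k A) where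
  smul_comp _ _ _ c f g := hom_ext fun m => by simp
  comp_smul _ _ _ f c g := hom_ext fun m => by simp

/-- The `k`-linear map underlying a morphism. -/
def klin {M N : FDMod k A} (f : M ⟶ N) : M →ₗ[k] N := (lin f).restrictScalars k

@[simp] theorem klin_apply {M N : FDMod k A} (f : M ⟶ N) (m : M) : klin f m = lin f m := rfl

/-- An isomorphism from a `k`-linear equivalence that commutes with the action of `A`. -/
def isoMk {M N : FDMod k A} (e : M ≃ₗ[k] N) (h : ∀ (a : A) (m : M), e (a • m) = a • e m) :
    M ≅ N where
  hom := ofLin { e with map_smul' := h }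
  inv := ofLin
    { e.symm with
      map_smul' := fun a n => e.injective <| by
        change e (e.symm (a • n)) = e (a • e.symm n)
        rw [h, e.apply_symm_apply, e.apply_symm_apply] }
  hom_inv_id := hom_ext fun m => e.symm_apply_apply m
  inv_hom_id := hom_ext fun m => e.apply_symm_apply m

@[simp] theorem lin_isoMk_hom {M N : FDMod k A} (e : M ≃ₗ[k] N) (h) (m : M) :
    lin (isoMk e h).hom m = e m := rfl
@[simp] theorem lin_isoMk_inv {M N : FDMod k A} (e : M ≃ₗ[k] N) (h) (m : N) :
    lin (isoMk e h).inv m = e.symm m := rfl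

end FDMod

/-! ### Left comodule algebras -/

/-- A left `H`-comodule algebra: an algebra `K` with a coassociative and counital coaction
`K → H ⊗ K` that is a morphism of algebras. -/
class LeftComoduleAlgebra (k H K : Type u) [Field k] [Ring H] [Bialgebra k H]
    [Ring K] [Algebra k K] where
  coact (k H K) : K →ₐ[k] H ⊗[k] K
  coassoc :
    (TensorProduct.assoc k H H K).toLinearMap ∘ₗ (Coalgebra.comul (R := k) (A := H)).rTensor K ∘ₗ
      coact.toLinearMap = coact.toLinearMap.lTensor H ∘ₗ coact.toLinearMap
  counit_coact :
    (TensorProduct.lid k K).toLinearMap ∘ₗ (Coalgebra.counit (R := k) (A := H)).rTensor K ∘ₗ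
      coact.toLinearMap = LinearMap.id

open LeftComoduleAlgebra (coact)

/-- The regular coaction of `H` on itself. -/
instance LeftComoduleAlgebra.self (k H : Type u) [Field k] [Ring H] [Bialgebra k H] :
    LeftComoduleAlgebra k H H where
  coact := Bialgebra.comulAlgHom k H
  coassoc := Coalgebra.coassoc
  counit_coact := by
    ext x
    simp

/-! ### The action of `Rep H` on modules over a comodule algebra -/

section Action

variable {k H K : Type u} [Field k] [Ring H] [Ring K]

/-- The action of `H ⊗ K` on `X ⊗ V`: `(h ⊗ a) • (x ⊗ v) = h • x ⊗ a • v`. -/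
def tensorAct (k H K : Type u) [Field k] [Ring H] [Ring K] [Algebra k H] [Algebra k K]
    (X V : Type u) [AddCommGroup X] [AddCommGroup V] [Module k X] [Module k V]
    [Module H X] [Module K V] [IsScalarTower k H X] [IsScalarTower k K V] :
    H ⊗[k] K →ₐ[k] Module.End k (X ⊗[k] V) :=
  (Module.endTensorEndAlgHom (R := k) (S := k) (A := k) (M := X) (N := V)).comp
    (Algebra.TensorProduct.map (Algebra.lsmul k k X) (Algebra.lsmul k k V))

@[simp]
theorem tensorAct_tmul [Algebra k H] [Algebra k K]
    (X V : Type u) [AddCommGroup X] [AddCommGroup V] [Module k X] [Module k V]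
    [Module H X] [Module K V] [IsScalarTower k H X] [IsScalarTower k K V]
    (h : H) (a : K) (x : X) (v : V) :
    tensorAct k H K X V (h ⊗ₜ a) (x ⊗ₜ v) = (h • x) ⊗ₜ (a • v) := rfl

variable [Bialgebra k H] [Algebra k K] [LeftComoduleAlgebra k H K]

/-- `X ⊗ V` with the action `a • (x ⊗ v) = a₋₁ • x ⊗ a₀ • v`. -/
def actObj (X : FDMod k H) (V : FDMod k K) : FDMod k K :=
  letI : Module K (X ⊗[k] V) :=
    Module.compHom (X ⊗[k] V) ((tensorAct k H K X V).comp (coact k H K)).toRingHom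
  { carrier := X ⊗[k] V
    isScalarTower := ⟨fun c a t => by
      change tensorAct k H K X V (coact k H K (c • a)) t =
        c • tensorAct k H K X V (coact k H K a) t
      simp⟩ }

/-- The identification of the underlying space of `actObj X V` with `X ⊗ V`. -/
def actEquiv (X : FDMod k H) (V : FDMod k K) : X ⊗[k] V ≃ₗ[k] actObj X V := LinearEquiv.refl k _

theorem smul_actEquiv (X : FDMod k H) (V : FDMod k K) (a : K) (t : X ⊗[k] V) :
    a • actEquiv X V t = actEquiv X V (tensorAct k H K X V (coact k H K a) t) := rfl


theorem act_ext {X : FDMod k H} {V : FDMod k K} {M : FDMod k K} {f g : actObj X V ⟶ M}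
    (h : ∀ (x : X) (v : V), FDMod.lin f (actEquiv X V (x ⊗ₜ v)) =
      FDMod.lin g (actEquiv X V (x ⊗ₜ v))) : f = g := by
  have : FDMod.klin f ∘ₗ (actEquiv X V).toLinearMap = FDMod.klin g ∘ₗ (actEquiv X V).toLinearMap :=
    TensorProduct.ext' h
  refine FDMod.hom_ext fun m => ?_
  obtain ⟨t, rfl⟩ := (actEquiv X V).surjective m
  exact LinearMap.congr_fun this t

/-- Construct a morphism out of `X ⊗ V`. -/
def actDesc {X : FDMod k H} {V : FDMod k K} {M : FDMod k K} (φ : X ⊗[k] V →ₗ[k] M)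
    (hφ : ∀ (a : K) (x : X) (v : V),
      φ (tensorAct k H K X V (coact k H K a) (x ⊗ₜ v)) = a • φ (x ⊗ₜ v)) : actObj X V ⟶ M :=
  FDMod.ofLin
    { toFun := fun t => φ ((actEquiv X V).symm t)
      map_add' := fun s t => by simp
      map_smul' := fun a t => by
        obtain ⟨t, rfl⟩ := (actEquiv X V).surjective t
        rw [smul_actEquiv]
        simp only [LinearEquiv.symm_apply_apply, RingHom.id_apply]
        induction t with
        | zero => simp
        | add s t hs ht => simp only [map_add, smul_add, hs, ht]
        | tmul x v => exact hφ a x v }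

@[simp]
theorem lin_actDesc {X : FDMod k H} {V : FDMod k K} {M : FDMod k K} (φ : X ⊗[k] V →ₗ[k] M) (hφ)
    (t : X ⊗[k] V) : FDMod.lin (actDesc φ hφ) (actEquiv X V t) = φ t := rfl

/-- The action on morphisms, `x ⊗ v ↦ f x ⊗ g v`. -/
def actMap {X X' : FDMod k H} {V V' : FDMod k K} (f : X ⟶ X') (g : V ⟶ V') :
    actObj X V ⟶ actObj X' V' :=
  actDesc ((actEquiv X' V').toLinearMap ∘ₗ TensorProduct.map (FDMod.klin f) (FDMod.klin g))
    (fun a x v => by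
      simp only [LinearMap.comp_apply, LinearEquiv.coe_coe, smul_actEquiv]
      congr 1
      induction coact k H K a with
      | zero => simp
      | add s t hs ht => simp only [map_add, LinearMap.add_apply, hs, ht]
      | tmul h b => simp)

@[simp]
theorem lin_actMap {X X' : FDMod k H} {V V' : FDMod k K} (f : X ⟶ X') (g : V ⟶ V')
    (x : X) (v : V) : FDMod.lin (actMap f g) (actEquiv X V (x ⊗ₜ v)) =
      actEquiv X' V' (FDMod.lin f x ⊗ₜ FDMod.lin g v) := rfl

theorem assoc_aux (X Y : FDMod k H) (V : FDMod k K) (x : X) (y : Y) (v : V) (a : K) :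
    (TensorProduct.congr (LinearEquiv.refl k X) (actEquiv Y V)) (TensorProduct.assoc k X Y V
      ((TensorProduct.congr (actEquiv X Y).symm (LinearEquiv.refl k V))
        (tensorAct k H K (actObj X Y) V (coact k H K a) (actEquiv X Y (x ⊗ₜ y) ⊗ₜ v)))) =
    tensorAct k H K X (actObj Y V) (coact k H K a) (x ⊗ₜ actEquiv Y V (y ⊗ₜ v)) := by
  let T : H ⊗[k] (H ⊗[k] K) →ₗ[k] X ⊗[k] actObj Y V :=
    TensorProduct.map (LinearMap.toSpanSingleton H X x |>.restrictScalars k)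
      ((actEquiv Y V).toLinearMap ∘ₗ (LinearMap.applyₗ (y ⊗ₜ v)) ∘ₗ
        (tensorAct k H K Y V).toLinearMap)
  have hT (h : H) (w : H ⊗[k] K) : T (h ⊗ₜ w) = (h • x) ⊗ₜ actEquiv Y V
    (tensorAct k H K Y V w (y ⊗ₜ v)) := rfl
  have h1 : ∀ u : H ⊗[k] K, (TensorProduct.congr (LinearEquiv.refl k X) (actEquiv Y V))
      (TensorProduct.assoc k X Y V
      ((TensorProduct.congr (actEquiv X Y).symm (LinearEquiv.refl k V))
        (tensorAct k H K (actObj X Y) V u (actEquiv X Y (x ⊗ₜ y) ⊗ₜ v)))) =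
      T (TensorProduct.assoc k H H K ((Coalgebra.comul (R := k) (A := H)).rTensor K u)) := by
    intro u
    induction u with
    | zero => simp
    | add s t hs ht => simp only [map_add, LinearMap.add_apply, hs, ht]
    | tmul h b =>
      simp only [tensorAct_tmul, smul_actEquiv, LinearMap.rTensor_tmul,
        TensorProduct.congr_tmul, LinearEquiv.symm_apply_apply, LinearEquiv.refl_apply]
      change _ = T (TensorProduct.assoc k H H K (coact k H H h ⊗ₜ b))
      induction coact k H H h with
      | zero => simp
      | add s t hs ht => simp only [map_add, LinearMap.add_apply, TensorProduct.add_tmul, hs, ht]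
      | tmul p q => simp [hT]
  have h2 : ∀ u : H ⊗[k] K, tensorAct k H K X (actObj Y V) u (x ⊗ₜ actEquiv Y V (y ⊗ₜ v)) =
      T ((coact k H K).toLinearMap.lTensor H u) := by
    intro u
    induction u with
    | zero => simp
    | add s t hs ht => simp only [map_add, LinearMap.add_apply, hs, ht]
    | tmul h b => simp [hT, smul_actEquiv]
  rw [h1, h2]
  congr 1
  exact LinearMap.congr_fun (LeftComoduleAlgebra.coassoc (k := k) (H := H) (K := K)) a

/-- The associativity isomorphism `(X ⊗ Y) ⊗ V ≅ X ⊗ (Y ⊗ V)`, `(x ⊗ y) ⊗ v ↦ x ⊗ (y ⊗ v)`. -/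
def actAssoc (X Y : FDMod k H) (V : FDMod k K) :
    actObj (actObj X Y) V ≅ actObj X (actObj Y V) :=
  FDMod.isoMk
    ((actEquiv (actObj X Y) V).symm.trans <|
      (TensorProduct.congr (actEquiv X Y).symm (LinearEquiv.refl k V)).trans <|
      (TensorProduct.assoc k X Y V).trans <|
      (TensorProduct.congr (LinearEquiv.refl k X) (actEquiv Y V)).trans
      (actEquiv X (actObj Y V)))
    (fun a t => by
      obtain ⟨t, rfl⟩ := (actEquiv (actObj X Y) V).surjective t
      rw [smul_actEquiv]
      induction t with
      | zero => simp
      | add s t hs ht => simp only [map_add, smul_add, hs, ht]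
      | tmul w v =>
        obtain ⟨w, rfl⟩ := (actEquiv X Y).surjective w
        induction w with
        | zero => simp
        | add s t hs ht => simp only [map_add, smul_add, TensorProduct.add_tmul, hs, ht]
        | tmul x y => exact congrArg (actEquiv X (actObj Y V)) (assoc_aux X Y V x y v a))

@[simp]
theorem lin_actAssoc_hom (X Y : FDMod k H) (V : FDMod k K) (x : X) (y : Y) (v : V) :
    FDMod.lin (actAssoc X Y V).hom (actEquiv (actObj X Y) V (actEquiv X Y (x ⊗ₜ y) ⊗ₜ v)) =
      actEquiv X (actObj Y V) (x ⊗ₜ actEquiv Y V (y ⊗ₜ v)) := rfl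

@[simp]
theorem lin_actAssoc_inv (X Y : FDMod k H) (V : FDMod k K) (x : X) (y : Y) (v : V) :
    FDMod.lin (actAssoc X Y V).inv (actEquiv X (actObj Y V) (x ⊗ₜ actEquiv Y V (y ⊗ₜ v))) =
      actEquiv (actObj X Y) V (actEquiv X Y (x ⊗ₜ y) ⊗ₜ v) := rfl

/-- The trivial module `k`, on which `H` acts through the counit. -/
def unitObj (k H : Type u) [Field k] [Ring H] [Bialgebra k H] : FDMod k H :=
  letI : Module H k := Module.compHom k (Bialgebra.counitAlgHom k H).toRingHom
  { carrier := k
    isScalarTower := ⟨fun c h t => by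
      change Coalgebra.counit (R := k) (c • h) * t = c • (Coalgebra.counit (R := k) h * t)
      simp [mul_assoc]⟩ }

/-- The identification of the underlying space of `unitObj` with `k`. -/
def unitEquiv (k H : Type u) [Field k] [Ring H] [Bialgebra k H] : k ≃ₗ[k] unitObj k H :=
  LinearEquiv.refl k k

theorem smul_unitEquiv (h : H) (c : k) :
    h • unitEquiv k H c = unitEquiv k H (Coalgebra.counit (R := k) h * c) := rfl

/-- The isomorphism `k ⊗ V ≅ V`, `c ⊗ v ↦ c • v`. -/
def actUnit (V : FDMod k K) : actObj (unitObj k H) V ≅ V :=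
  FDMod.isoMk
    ((actEquiv (unitObj k H) V).symm.trans <|
      (TensorProduct.congr (unitEquiv k H).symm (LinearEquiv.refl k V)).trans <|
      TensorProduct.lid k V)
    (fun a t => by
      obtain ⟨t, rfl⟩ := (actEquiv (unitObj k H) V).surjective t
      rw [smul_actEquiv]
      induction t with
      | zero => simp
      | add s t hs ht => simp only [map_add, smul_add, hs, ht]
      | tmul c v =>
        obtain ⟨c, rfl⟩ := (unitEquiv k H).surjective c
        have key : ∀ u : H ⊗[k] K, (TensorProduct.lid k V)
            ((TensorProduct.congr (unitEquiv k H).symm (LinearEquiv.refl k V))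
              (tensorAct k H K (unitObj k H) V u (unitEquiv k H c ⊗ₜ v))) =
            c • (TensorProduct.lid k K (Coalgebra.counit.rTensor K u)) • v := by
          intro u
          induction u with
          | zero => simp
          | add s t hs ht => simp only [map_add, LinearMap.add_apply, hs, ht, add_smul, smul_add]
          | tmul h b => simp [smul_unitEquiv, mul_comm, mul_smul]
        have h2 := LinearMap.congr_fun
          (LeftComoduleAlgebra.counit_coact (k := k) (H := H) (K := K)) a
        simp only [LinearMap.comp_apply, LinearEquiv.coe_coe, AlgHom.toLinearMap_apply,
          LinearMap.id_apply] at h2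
        simp only [LinearEquiv.trans_apply, LinearEquiv.symm_apply_apply, key, h2]
        exact (smul_comm a c v).symm)

@[simp]
theorem lin_actUnit_hom (V : FDMod k K) (c : k) (v : V) :
    FDMod.lin (actUnit (H := H) V).hom (actEquiv (unitObj k H) V (unitEquiv k H c ⊗ₜ v)) = c • v :=
  rfl

@[simp]
theorem lin_actUnit_inv (V : FDMod k K) (v : V) :
    FDMod.lin (actUnit (H := H) V).inv v = actEquiv (unitObj k H) V (unitEquiv k H 1 ⊗ₜ v) := rfl

/-- The isomorphism `X ⊗ k ≅ X`, `x ⊗ c ↦ c • x`. -/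
def rightUnit (X : FDMod k H) : actObj X (unitObj k H) ≅ X :=
  FDMod.isoMk
    ((actEquiv X (unitObj k H)).symm.trans <|
      (TensorProduct.congr (LinearEquiv.refl k X) (unitEquiv k H).symm).trans <|
      TensorProduct.rid k X)
    (fun a t => by
      obtain ⟨t, rfl⟩ := (actEquiv X (unitObj k H)).surjective t
      rw [smul_actEquiv]
      induction t with
      | zero => simp
      | add s t hs ht => simp only [map_add, smul_add, hs, ht]
      | tmul x c =>
        obtain ⟨c, rfl⟩ := (unitEquiv k H).surjective c
        have key : ∀ u : H ⊗[k] H, (TensorProduct.rid k X)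
            ((TensorProduct.congr (LinearEquiv.refl k X) (unitEquiv k H).symm)
              (tensorAct k H H X (unitObj k H) u (x ⊗ₜ unitEquiv k H c))) =
            c • (TensorProduct.rid k H (Coalgebra.counit.lTensor H u)) • x := by
          intro u
          induction u with
          | zero => simp
          | add s t hs ht => simp only [map_add, LinearMap.add_apply, hs, ht, add_smul, smul_add]
          | tmul h b => simp [smul_unitEquiv, mul_comm, mul_smul]
        have h2 : TensorProduct.rid k H (Coalgebra.counit.lTensor H (coact k H H a)) = a := by
          change TensorProduct.rid k H (Coalgebra.counit.lTensor H (Coalgebra.comul a)) = a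
          simp
        simp only [LinearEquiv.trans_apply, LinearEquiv.symm_apply_apply, key, h2]
        exact (smul_comm a c x).symm)

@[simp]
theorem lin_rightUnit_hom (X : FDMod k H) (c : k) (x : X) :
    FDMod.lin (rightUnit X).hom (actEquiv X (unitObj k H) (x ⊗ₜ unitEquiv k H c)) = c • x :=
  rfl

theorem act_ext₃ {X Y : FDMod k H} {V M : FDMod k K} {f g : actObj X (actObj Y V) ⟶ M}
    (h : ∀ (x : X) (y : Y) (v : V),
      FDMod.lin f (actEquiv X _ (x ⊗ₜ actEquiv Y V (y ⊗ₜ v))) =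
      FDMod.lin g (actEquiv X _ (x ⊗ₜ actEquiv Y V (y ⊗ₜ v)))) : f = g := by
  refine act_ext fun x w => ?_
  obtain ⟨t, rfl⟩ := (actEquiv Y V).surjective w
  induction t with
  | zero => simp
  | add s t hs ht => simp only [map_add, TensorProduct.tmul_add, hs, ht]
  | tmul y v => exact h x y v

theorem act_ext₃' {X Y : FDMod k H} {V M : FDMod k K} {f g : actObj (actObj X Y) V ⟶ M}
    (h : ∀ (x : X) (y : Y) (v : V),
      FDMod.lin f (actEquiv _ V (actEquiv X Y (x ⊗ₜ y) ⊗ₜ v)) =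
      FDMod.lin g (actEquiv _ V (actEquiv X Y (x ⊗ₜ y) ⊗ₜ v))) : f = g := by
  have := act_ext₃ (f := (actAssoc X Y V).inv ≫ f) (g := (actAssoc X Y V).inv ≫ g)
    (fun x y v => by simpa using h x y v)
  simpa using this

theorem act_ext₄ {X Y Z : FDMod k H} {V M : FDMod k K}
    {f g : actObj (actObj (actObj X Y) Z) V ⟶ M}
    (h : ∀ (x : X) (y : Y) (z : Z) (v : V),
      FDMod.lin f (actEquiv _ V (actEquiv _ Z (actEquiv X Y (x ⊗ₜ y) ⊗ₜ z) ⊗ₜ v)) =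
      FDMod.lin g (actEquiv _ V (actEquiv _ Z (actEquiv X Y (x ⊗ₜ y) ⊗ₜ z) ⊗ₜ v))) : f = g := by
  refine act_ext₃' fun w z v => ?_
  obtain ⟨t, rfl⟩ := (actEquiv X Y).surjective w
  induction t with
  | zero => simp
  | add s t hs ht => simp only [map_add, TensorProduct.add_tmul, hs, ht]
  | tmul x y => exact h x y z v

/-- The monoidal category `Rep H` of finite-dimensional `H`-modules. -/
instance : MonoidalCategory (FDMod k H) where
  tensorObj X Y := actObj X Y
  tensorHom f g := actMap f g
  whiskerLeft X _ _ g := actMap (𝟙 X) g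
  whiskerRight f Y := actMap f (𝟙 Y)
  tensorUnit := unitObj k H
  associator X Y Z := actAssoc X Y Z
  leftUnitor X := actUnit X
  rightUnitor X := rightUnit X
  tensorHom_def f g := act_ext fun x y => by simp
  id_tensorHom_id X Y := act_ext fun x y => by simp
  tensorHom_comp_tensorHom f₁ f₂ g₁ g₂ := act_ext fun x y => by simp
  whiskerLeft_id X Y := act_ext fun x y => by simp
  id_whiskerRight X Y := act_ext fun x y => by simp
  associator_naturality f g h := act_ext₃' fun x y z => by simp
  leftUnitor_naturality f := act_ext fun c x => by
    obtain ⟨c, rfl⟩ := (unitEquiv k H).surjective c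
    simp
  rightUnitor_naturality f := act_ext fun x c => by
    obtain ⟨c, rfl⟩ := (unitEquiv k H).surjective c
    simp
  pentagon W X Y Z := act_ext₄ fun w x y z => by simp
  triangle X Y := act_ext₃' fun x c y => by
    obtain ⟨c, rfl⟩ := (unitEquiv k H).surjective c
    simp [← TensorProduct.smul_tmul']

/-- The action of `Rep H` on the finite-dimensional modules over the `H`-comodule algebra `K`. -/
instance : MonoidalLeftAction (FDMod k H) (FDMod k K) where
  actionObj X V := actObj X V
  actionHomLeft f V := actMap f (𝟙 V)
  actionHomRight X _ _ g := actMap (𝟙 X) g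
  actionHom f g := actMap f g
  actionAssocIso X Y V := actAssoc X Y V
  actionUnitIso V := actUnit V
  actionHom_def f g := act_ext fun x y => by simp
  actionHomRight_id X V := act_ext fun x y => by simp
  id_actionHomLeft X V := act_ext fun x y => by simp
  actionHom_comp f₁ f₂ g₁ g₂ := act_ext fun x y => by simp
  actionAssocIso_hom_naturality f g h := act_ext₃' fun x y z => rfl
  actionUnitIso_hom_naturality f := act_ext fun c x => by
    obtain ⟨c, rfl⟩ := (unitEquiv k H).surjective c
    exact (FDMod.klin f).map_smul c x
  whiskerLeft_actionHomLeft X _ _ f V := act_ext₃' fun x y z => rfl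
  whiskerRight_actionHomLeft X f V := act_ext₃' fun x y z => rfl
  associator_actionHom X Y Z V := act_ext₄ fun w x y z => rfl
  leftUnitor_actionHom X V := act_ext₃' fun c x v => by
    obtain ⟨c, rfl⟩ := (unitEquiv k H).surjective c
    change actEquiv X V ((c • x) ⊗ₜ v) = c • actEquiv X V (x ⊗ₜ v)
    rw [← TensorProduct.smul_tmul', map_smul]
  rightUnitor_actionHom X V := act_ext₃' fun x c v => by
    obtain ⟨c, rfl⟩ := (unitEquiv k H).surjective c
    change actEquiv X V ((c • x) ⊗ₜ v) = actEquiv X V (x ⊗ₜ (c • v))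
    rw [TensorProduct.smul_tmul]

end Action
/-! ### Module functors -/

section ModuleFunctor

open MonoidalLeftAction CategoryTheory.Functor OplaxLeftLinear

universe v₁ v₂ v₃ v₄ w₁ w₂ w₃ w₄ w

variable {k : Type w} [Field k] {C : Type w₁} [Category.{v₁} C] [MonoidalCategory C]
  {D : Type w₂} [Category.{v₂} D] [MonoidalLeftAction C D]
  {D' : Type w₃} [Category.{v₃} D'] [MonoidalLeftAction C D']
  {D'' : Type w₄} [Category.{v₄} D''] [MonoidalLeftAction C D'']

/-- The identity functor with `c = id`. -/
instance : (𝟭 D).OplaxLeftLinear C where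
  δₗ X M := 𝟙 (X ⊙ₗ M)

/-- The composition of `(F, c)` and `(G, d)` is `(G ∘ F, d ∘ G(c))`. -/
instance (F : D ⥤ D') (G : D' ⥤ D'') [F.OplaxLeftLinear C] [G.OplaxLeftLinear C] :
    (F ⋙ G).OplaxLeftLinear C where
  δₗ X M := G.map (δₗ F X M) ≫ δₗ G X (F.obj M)
  δₗ_naturality_left f d := by
    rw [Functor.comp_map, ← Category.assoc, ← G.map_comp, δₗ_naturality_left, G.map_comp,
      Category.assoc, δₗ_naturality_left, Category.assoc]
    rfl
  δₗ_naturality_right X d d' f := by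
    rw [Functor.comp_map, ← Category.assoc, ← G.map_comp, δₗ_naturality_right, G.map_comp,
      Category.assoc, δₗ_naturality_right, Category.assoc, Functor.comp_map]
  δₗ_associativity X Y M := by
    simp only [Functor.comp_map, Functor.comp_obj, Category.assoc, δₗ_associativity,
      actionHomRight_comp]
    rw [← Functor.map_comp_assoc, δₗ_associativity]
    simp only [Functor.map_comp, Category.assoc, δₗ_naturality_right_assoc]
  δₗ_unitality_inv M := by
    simp only [Functor.comp_map, Functor.comp_obj, ← Category.assoc, ← Functor.map_comp,
      ← δₗ_unitality_inv]

variable (k C D D' D'')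
  [Preadditive D] [Preadditive D'] [Preadditive D'']
  [CategoryTheory.Linear k D] [CategoryTheory.Linear k D'] [CategoryTheory.Linear k D'']

/-- A `k`-linear functor `F` with a coherent natural transformation
`c : F (X ⊗ M) ⟶ X ⊗ F M`, not required to be invertible. -/
structure OplaxModuleFunctor where
  functor : D ⥤ D'
  [additive : functor.Additive]
  [linear : functor.Linear k]
  [oplax : functor.OplaxLeftLinear C]

attribute [instance] OplaxModuleFunctor.additive OplaxModuleFunctor.linear
  OplaxModuleFunctor.oplax

namespace OplaxModuleFunctor

variable {k C D D' D''}

/-- `(F, c)` is a module functor: the transformation `c` is an isomorphism. -/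
def IsModuleFunctor (F : OplaxModuleFunctor k C D D') : Prop :=
  ∀ (X : C) (M : D), IsIso (δₗ F.functor X M)

/-- Morphisms `(F, c) ⟶ (G, d)`: the natural transformations `α : F ⟶ G` such that
`d ∘ α = (id ⊗ α) ∘ c`. -/
@[ext]
structure Hom (F G : OplaxModuleFunctor k C D D') where
  natTrans : F.functor ⟶ G.functor
  comm : ∀ (X : C) (M : D), natTrans.app (X ⊙ₗ M) ≫ δₗ G.functor X M =
    δₗ F.functor X M ≫ X ⊴ₗ natTrans.app M

instance : Category (OplaxModuleFunctor k C D D') where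
  Hom F G := Hom F G
  id F := ⟨𝟙 _, fun X M => by simp⟩
  comp α β := ⟨α.natTrans ≫ β.natTrans, fun X M => by
    simp only [NatTrans.comp_app, Category.assoc, β.comm, actionHomRight_comp]
    rw [← Category.assoc, α.comm, Category.assoc]⟩

variable (k C D) in
/-- The identity module functor. -/
def id : OplaxModuleFunctor k C D D where
  functor := 𝟭 D

/-- The composition of module functors, in diagrammatic order. -/
def comp (F : OplaxModuleFunctor k C D D') (G : OplaxModuleFunctor k C D' D'') :
    OplaxModuleFunctor k C D D'' where
  functor := F.functor ⋙ G.functor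

/-- `(F, c)` is an equivalence of module categories: a module functor with a quasi-inverse module
functor, up to natural isomorphisms of module functors. -/
def IsModuleEquivalence (F : OplaxModuleFunctor k C D D') : Prop :=
  F.IsModuleFunctor ∧ ∃ G : OplaxModuleFunctor k C D' D, G.IsModuleFunctor ∧
    Nonempty (id k C D ≅ F.comp G) ∧ Nonempty (id k C D' ≅ G.comp F)

end OplaxModuleFunctor

/-- The category of equivalences of module categories from `D` to `D'`. -/
abbrev ModuleEquivalence : Type _ :=
  ObjectProperty.FullSubcategory
    (fun F : OplaxModuleFunctor k C D D' => F.IsModuleEquivalence)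

end ModuleFunctor

/-! ### Bimodules and equivariant bimodules -/

/-- A finite-dimensional `(S, R)`-bimodule over `k`; the right action is `p * r = op r • p`. -/
structure FDBimod (k S R : Type u) [Field k] [Ring S] [Ring R] [Algebra k S] [Algebra k R] where
  carrier : Type u
  [addCommGroup : AddCommGroup carrier]
  [baseModule : Module k carrier]
  [leftModule : Module S carrier]
  [rightModule : Module Rᵐᵒᵖ carrier]
  [leftTower : IsScalarTower k S carrier]
  [rightTower : IsScalarTower k Rᵐᵒᵖ carrier]
  [smulComm : SMulCommClass S Rᵐᵒᵖ carrier]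
  [finite : FiniteDimensional k carrier]

section Bimod

variable {k H S R : Type u} [Field k] [Ring H] [Ring S] [Ring R] [Bialgebra k H]
  [Algebra k S] [Algebra k R]

namespace FDBimod

instance : CoeSort (FDBimod k S R) (Type u) := ⟨FDBimod.carrier⟩

attribute [instance] addCommGroup baseModule leftModule rightModule leftTower rightTower smulComm
  finite

variable (P : FDBimod k S R)

/-- The right action as a bilinear map `(p, r) ↦ p * r`. -/
def rightAct : P →ₗ[k] R →ₗ[k] P :=
  LinearMap.mk₂ k (fun p r => op r • p) (fun _ _ _ => smul_add _ _ _)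
    (fun c p r => (smul_comm c (op r) p).symm)
    (fun p r r' => by simp [add_smul]) (fun c p r => by simp)

@[simp] theorem rightAct_apply (p : P) (r : R) : P.rightAct p r = op r • p := rfl

section BalTensor

variable (V : Type u) [AddCommGroup V] [Module k V] [Module R V]

/-- The `S`-submodule (equivalently, the subgroup) of `P ⊗ V` generated by the elements
`p * r ⊗ v - p ⊗ r • v`. -/
def balRel : Submodule S (P ⊗[k] V) :=
  Submodule.span S {t | ∃ (p : P) (r : R) (v : V), t = (op r • p) ⊗ₜ v - p ⊗ₜ (r • v)}

/-- The tensor product `P ⊗_R V` over the (noncommutative) algebra `R`, a left `S`-module. -/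
abbrev BalTensor : Type u := (P ⊗[k] V) ⧸ P.balRel V

/-- The class of `p ⊗ v` in `P ⊗_R V`, as a bilinear map. -/
def balMk : P →ₗ[k] V →ₗ[k] P.BalTensor V :=
  TensorProduct.curry ((P.balRel V).mkQ.restrictScalars k)

variable {V}

theorem balMk_apply (p : P) (v : V) : P.balMk V p v = (P.balRel V).mkQ (p ⊗ₜ v) := rfl

theorem balMk_smul (p : P) (r : R) (v : V) :
    P.balMk V (op r • p) v = P.balMk V p (r • v) := by
  rw [balMk_apply, balMk_apply, ← sub_eq_zero, ← map_sub, Submodule.mkQ_apply,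
    Submodule.Quotient.mk_eq_zero]
  exact Submodule.subset_span ⟨p, r, v, rfl⟩

theorem smul_balMk (p : P) (s : S) (v : V) :
    s • P.balMk V p v = P.balMk V (s • p) v := rfl

end BalTensor

end FDBimod

variable [LeftComoduleAlgebra k H S] [LeftComoduleAlgebra k H R]

/-- A left coaction `ρ : P → H ⊗ P` makes the bimodule `P` equivariant if it is coassociative,
counital, and a morphism of `(S, R)`-bimodules, where
`s • (h ⊗ p) * r = s₋₁ h r₋₁ ⊗ s₀ • p * r₀`. -/
structure IsEquivariantCoaction (P : FDBimod k S R) (ρ : P →ₗ[k] H ⊗[k] P) : Prop where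
  coassoc : (TensorProduct.assoc k H H P).toLinearMap ∘ₗ
    (Coalgebra.comul (R := k) (A := H)).rTensor P ∘ₗ ρ = ρ.lTensor H ∘ₗ ρ
  counit_coact : (TensorProduct.lid k P).toLinearMap ∘ₗ
    (Coalgebra.counit (R := k) (A := H)).rTensor P ∘ₗ ρ = LinearMap.id
  map_smul : ∀ (s : S) (p : P), ρ (s • p) =
    tensorBilin (LinearMap.mul k H) (Algebra.lsmul k k P).toLinearMap (coact k H S s) (ρ p)
  map_op_smul : ∀ (p : P) (r : R), ρ (op r • p) =
    tensorBilin (LinearMap.mul k H) P.rightAct (ρ p) (coact k H R r)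

variable (k H S R) in
/-- An equivariant `(S, R)`-bimodule. -/
structure EquivBimod where
  bimod : FDBimod k S R
  coaction : bimod →ₗ[k] H ⊗[k] bimod
  isEquivariant : IsEquivariantCoaction bimod coaction

/-! ### The functor `P ⊗_R -` of an equivariant bimodule -/

namespace EquivBimod

variable (P : EquivBimod k H S R)

/-- The object `P ⊗_R V`. -/
def tensorObj (V : FDMod k R) : FDMod k S where
  carrier := P.bimod.BalTensor V

/-- `P ⊗_R f`, `p ⊗ v ↦ p ⊗ f v`. -/
def tensorMap {V W : FDMod k R} (f : V ⟶ W) : P.tensorObj V ⟶ P.tensorObj W :=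
  FDMod.ofLin <| Submodule.mapQ (P.bimod.balRel V) (P.bimod.balRel W)
    (TensorProduct.AlgebraTensorModule.map LinearMap.id (FDMod.klin f)) <| by
      refine Submodule.span_le.2 ?_
      rintro _ ⟨p, r, v, rfl⟩
      exact Submodule.subset_span ⟨p, r, FDMod.lin f v, by simp⟩

/-- The class of `p ⊗ v` in `P ⊗_R V`, as a bilinear map. -/
def tmk (V : FDMod k R) : P.bimod →ₗ[k] V →ₗ[k] P.tensorObj V := P.bimod.balMk V

theorem tmk_smul {V : FDMod k R} (p : P.bimod) (r : R) (v : V) :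
    P.tmk V (op r • p) v = P.tmk V p (r • v) := P.bimod.balMk_smul p r v

theorem smul_tmk {V : FDMod k R} (p : P.bimod) (s : S) (v : V) :
    s • P.tmk V p v = P.tmk V (s • p) v := rfl

@[simp]
theorem lin_tensorMap_tmk {V W : FDMod k R} (f : V ⟶ W) (p : P.bimod) (v : V) :
    FDMod.lin (P.tensorMap f) (P.tmk V p v) = P.tmk W p (FDMod.lin f v) := rfl

theorem tensorObj_induction {V : FDMod k R} {motive : P.tensorObj V → Prop}
    (zero : motive 0) (mk : ∀ p v, motive (P.tmk V p v))
    (add : ∀ x y, motive x → motive y → motive (x + y)) (x : P.tensorObj V) : motive x := by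
  obtain ⟨t, rfl⟩ := (P.bimod.balRel V).mkQ_surjective x
  induction t with
  | zero => exact zero
  | tmul p v => exact mk p v
  | add s t hs ht => rw [map_add]; exact add _ _ hs ht

theorem tensorObj_ext {V : FDMod k R} {M : FDMod k S} {f g : P.tensorObj V ⟶ M}
    (h : ∀ p v, FDMod.lin f (P.tmk V p v) = FDMod.lin g (P.tmk V p v)) : f = g :=
  FDMod.hom_ext fun m => P.tensorObj_induction
    (motive := fun m => FDMod.lin f m = FDMod.lin g m) (by simp) h
    (fun x y hx hy => by rw [map_add, map_add, hx, hy]) m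

theorem tensorMap_id (V : FDMod k R) : P.tensorMap (𝟙 V) = 𝟙 (P.tensorObj V) :=
  P.tensorObj_ext fun p v => by simp

/-- The bilinear map `(h ⊗ p, x ⊗ v) ↦ h • x ⊗ (p ⊗ v)`. -/
def preLineator (X : FDMod k H) (V : FDMod k R) :
    H ⊗[k] P.bimod →ₗ[k] X ⊗[k] V →ₗ[k] X ⊗[k] P.tensorObj V :=
  tensorBilin (Algebra.lsmul k k X).toLinearMap (P.tmk V)

/-- The map `P ⊗ (X ⊗ V) → X ⊗ (P ⊗_R V)`, `p ⊗ x ⊗ v ↦ p₋₁ • x ⊗ (p₀ ⊗ v)`. -/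
def lineatorBilin (X : FDMod k H) (V : FDMod k R) :
    P.bimod →ₗ[k] actObj X V →ₗ[k] actObj X (P.tensorObj V) :=
  (LinearMap.compr₂ (P.preLineator X V) (actEquiv X (P.tensorObj V)).toLinearMap).compl₁₂
    P.coaction (actEquiv X V).symm.toLinearMap

theorem lineatorBilin_apply (X : FDMod k H) (V : FDMod k R) (p : P.bimod) (t : X ⊗[k] V) :
    P.lineatorBilin X V p (actEquiv X V t) =
      actEquiv X (P.tensorObj V) (P.preLineator X V (P.coaction p) t) := rfl

theorem lineatorBilin_smul (X : FDMod k H) (V : FDMod k R) (s : S) (p : P.bimod)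
    (w : actObj X V) : P.lineatorBilin X V (s • p) w = s • P.lineatorBilin X V p w := by
  obtain ⟨t, rfl⟩ := (actEquiv X V).surjective w
  rw [lineatorBilin_apply, lineatorBilin_apply, P.isEquivariant.map_smul, smul_actEquiv]
  congr 1
  generalize P.coaction p = q
  induction coact k H S s with
  | zero => simp
  | add a b ha hb => simp only [map_add, LinearMap.add_apply, ha, hb]
  | tmul h s =>
    induction q with
    | zero => simp
    | add a b ha hb => simp only [map_add, LinearMap.add_apply, ha, hb]
    | tmul h' p =>
      induction t with
      | zero => simp
      | add a b ha hb => simp only [map_add, ha, hb]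
      | tmul x v => simp [preLineator, smul_tmk]

theorem lineatorBilin_op_smul (X : FDMod k H) (V : FDMod k R) (r : R) (p : P.bimod)
    (w : actObj X V) : P.lineatorBilin X V (op r • p) w = P.lineatorBilin X V p (r • w) := by
  obtain ⟨t, rfl⟩ := (actEquiv X V).surjective w
  rw [smul_actEquiv, lineatorBilin_apply, lineatorBilin_apply, P.isEquivariant.map_op_smul]
  congr 1
  generalize P.coaction p = q
  induction coact k H R r with
  | zero => simp
  | add a b ha hb => simp only [map_add, LinearMap.add_apply, ha, hb]
  | tmul h r =>
    induction q with
    | zero => simp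
    | add a b ha hb => simp only [map_add, LinearMap.add_apply, ha, hb]
    | tmul h' p =>
      induction t with
      | zero => simp
      | add a b ha hb => simp only [map_add, ha, hb]
      | tmul x v => simp [preLineator, tmk_smul]

/-- The morphism `c : P ⊗_R (X ⊗ V) ⟶ X ⊗ (P ⊗_R V)`, `p ⊗ x ⊗ v ↦ p₋₁ • x ⊗ (p₀ ⊗ v)`. -/
def lineator (X : FDMod k H) (V : FDMod k R) :
    P.tensorObj (actObj X V) ⟶ actObj X (P.tensorObj V) :=
  FDMod.ofLin <| Submodule.liftQ (P.bimod.balRel (actObj X V))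
    (TensorProduct.AlgebraTensorModule.lift
      { toFun := fun p => P.lineatorBilin X V p
        map_add' := fun p q => map_add _ p q
        map_smul' := fun s p => LinearMap.ext fun w => P.lineatorBilin_smul X V s p w })
    (by
      refine Submodule.span_le.2 ?_
      rintro _ ⟨p, r, w, rfl⟩
      simp only [SetLike.mem_coe, LinearMap.mem_ker, map_sub, sub_eq_zero]
      exact P.lineatorBilin_op_smul X V r p w)

@[simp]
theorem lin_lineator_tmk (X : FDMod k H) (V : FDMod k R) (p : P.bimod) (t : X ⊗[k] V) :
    FDMod.lin (P.lineator X V) (P.tmk _ p (actEquiv X V t)) =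
      actEquiv X (P.tensorObj V) (P.preLineator X V (P.coaction p) t) := rfl

theorem lineator_naturality {X X' : FDMod k H} {V V' : FDMod k R} (f : X ⟶ X') (g : V ⟶ V')
    (p : P.bimod) (t : X ⊗[k] V) :
    FDMod.lin (P.tensorMap (actMap f g) ≫ P.lineator X' V') (P.tmk _ p (actEquiv X V t)) =
      FDMod.lin (P.lineator X V ≫ actMap f (P.tensorMap g)) (P.tmk _ p (actEquiv X V t)) := by
  change actEquiv X' (P.tensorObj V') (P.preLineator X' V' (P.coaction p)
    (TensorProduct.map (FDMod.klin f) (FDMod.klin g) t)) =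
    actEquiv X' (P.tensorObj V') (TensorProduct.map (FDMod.klin f) (FDMod.klin (P.tensorMap g))
      (P.preLineator X V (P.coaction p) t))
  congr 1
  induction P.coaction p with
  | zero => simp
  | add a b ha hb => simp only [map_add, LinearMap.add_apply, ha, hb]
  | tmul h p =>
    induction t with
    | zero => simp
    | add a b ha hb => simp only [map_add, ha, hb]
    | tmul x v => simp [preLineator]

theorem lineator_associativity (X Y : FDMod k H) (V : FDMod k R) (p : P.bimod)
    (w : actObj (actObj X Y) V) :
    FDMod.lin (P.lineator (actObj X Y) V ≫ (actAssoc X Y (P.tensorObj V)).hom) (P.tmk _ p w) =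
      FDMod.lin (P.tensorMap (actAssoc X Y V).hom ≫ P.lineator X (actObj Y V) ≫
        actMap (𝟙 X) (P.lineator Y V)) (P.tmk _ p w) := by
  obtain ⟨w, rfl⟩ := (actEquiv _ V).surjective w
  induction w with
  | zero => simp
  | add a b ha hb => simp only [map_add, ha, hb]
  | tmul w v =>
  obtain ⟨w, rfl⟩ := (actEquiv X Y).surjective w
  induction w with
  | zero => simp
  | add a b ha hb => simp only [map_add, TensorProduct.add_tmul, ha, hb]
  | tmul x y =>
  let T : H ⊗[k] (H ⊗[k] P.bimod) →ₗ[k] X ⊗[k] actObj Y (P.tensorObj V) :=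
    TensorProduct.map (LinearMap.toSpanSingleton H X x |>.restrictScalars k)
      ((actEquiv Y (P.tensorObj V)).toLinearMap ∘ₗ
        (P.preLineator Y V).flip (y ⊗ₜ v))
  have hT (h : H) (w : H ⊗[k] P.bimod) : T (h ⊗ₜ w) = (h • x) ⊗ₜ
    actEquiv Y (P.tensorObj V) (P.preLineator Y V w (y ⊗ₜ v)) := rfl
  have h1 : ∀ u : H ⊗[k] P.bimod, FDMod.lin (actAssoc X Y (P.tensorObj V)).hom
      (actEquiv _ _ (P.preLineator (actObj X Y) V u (actEquiv X Y (x ⊗ₜ y) ⊗ₜ v))) =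
      actEquiv _ _ (T (TensorProduct.assoc k H H P.bimod
        ((Coalgebra.comul (R := k) (A := H)).rTensor P.bimod u))) := by
    intro u
    induction u with
    | zero => simp
    | add s t hs ht => simp only [map_add, LinearMap.add_apply, hs, ht]
    | tmul h q =>
      simp only [preLineator, tensorBilin_tmul, AlgHom.toLinearMap_apply, Algebra.lsmul_coe,
        smul_actEquiv, LinearMap.rTensor_tmul]
      change _ = actEquiv _ _ (T (TensorProduct.assoc k H H P.bimod (coact k H H h ⊗ₜ q)))
      induction coact k H H h with
      | zero => simp
      | add s t hs ht => simp only [map_add, LinearMap.add_apply, TensorProduct.add_tmul, hs, ht]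
      | tmul p q => simp [hT, preLineator]
  have h2 : ∀ u : H ⊗[k] P.bimod, FDMod.lin (actMap (𝟙 X) (P.lineator Y V))
      (actEquiv _ _ (P.preLineator X (actObj Y V) u (x ⊗ₜ actEquiv Y V (y ⊗ₜ v)))) =
      actEquiv _ _ (T (P.coaction.lTensor H u)) := by
    intro u
    induction u with
    | zero => simp
    | add s t hs ht => simp only [map_add, LinearMap.add_apply, hs, ht]
    | tmul h b => simp [hT, preLineator]
  simp only [FDMod.lin_comp, LinearMap.comp_apply, lin_tensorMap_tmk, lin_lineator_tmk,
    lin_actAssoc_hom, h1, h2]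
  exact congrArg (fun z => actEquiv _ _ (T z)) (LinearMap.congr_fun P.isEquivariant.coassoc p)

theorem lineator_unitality (V : FDMod k R) (p : P.bimod) (v : V) :
    FDMod.lin (actUnit (H := H) (P.tensorObj V)).inv (P.tmk V p v) =
      FDMod.lin (P.tensorMap (actUnit (H := H) V).inv ≫ P.lineator (unitObj k H) V)
        (P.tmk V p v) := by
  have h1 : ∀ u : H ⊗[k] P.bimod, actEquiv (unitObj k H) (P.tensorObj V) (unitEquiv k H 1 ⊗ₜ
      P.tmk V (TensorProduct.lid k P.bimod (Coalgebra.counit.rTensor P.bimod u)) v) =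
      actEquiv (unitObj k H) (P.tensorObj V)
        (P.preLineator (unitObj k H) V u (unitEquiv k H 1 ⊗ₜ v)) := by
    intro u
    induction u with
    | zero => simp
    | add s t hs ht =>
      simp only [map_add, LinearMap.add_apply, TensorProduct.tmul_add, hs, ht]
    | tmul h q =>
      have : unitEquiv k H (Coalgebra.counit (R := k) h) =
        Coalgebra.counit (R := k) h • unitEquiv k H 1 := by
        rw [← map_smul, smul_eq_mul, mul_one]
      simp [preLineator, smul_unitEquiv, this, ← TensorProduct.smul_tmul']
  have h2 := LinearMap.congr_fun P.isEquivariant.counit_coact p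
  simp only [LinearMap.comp_apply, LinearEquiv.coe_coe, LinearMap.id_apply] at h2
  simp only [FDMod.lin_comp, LinearMap.comp_apply, lin_tensorMap_tmk, lin_lineator_tmk,
    lin_actUnit_inv, ← h1, h2]

/-- The functor `P ⊗_R -`. -/
def tensorFunctor : FDMod k R ⥤ FDMod k S where
  obj V := P.tensorObj V
  map f := P.tensorMap f
  map_id V := P.tensorObj_ext fun p v => by simp
  map_comp f g := P.tensorObj_ext fun p v => by simp

instance : P.tensorFunctor.Additive where
  map_add {_ W f g} := P.tensorObj_ext fun p v =>
    (P.tmk W p).map_add (FDMod.lin f v) (FDMod.lin g v)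

instance : P.tensorFunctor.Linear k where
  map_smul {_ W} f c := P.tensorObj_ext fun p v => (P.tmk W p).map_smul c (FDMod.lin f v)

instance : P.tensorFunctor.OplaxLeftLinear (FDMod k H) where
  δₗ X V := P.lineator X V
  δₗ_naturality_left {X X'} f V := P.tensorObj_ext fun p w => by
    obtain ⟨t, rfl⟩ := (actEquiv X V).surjective w
    have h := P.lineator_naturality f (𝟙 V) p t
    rw [tensorMap_id] at h
    exact h
  δₗ_naturality_right X V V' f := P.tensorObj_ext fun p w => by
    obtain ⟨t, rfl⟩ := (actEquiv X V).surjective w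
    exact P.lineator_naturality (𝟙 X) f p t
  δₗ_associativity X Y V := P.tensorObj_ext fun p w => P.lineator_associativity X Y V p w
  δₗ_unitality_inv V := P.tensorObj_ext fun p v => P.lineator_unitality V p v

/-- The functor `P ⊗_R -` with the transformation `p ⊗ x ⊗ v ↦ p₋₁ • x ⊗ (p₀ ⊗ v)`. -/
def moduleFunctor : OplaxModuleFunctor k (FDMod k H) (FDMod k R) (FDMod k S) where
  functor := P.tensorFunctor

end EquivBimod

end Bimod

/-! ### Morita contexts -/

section Morita

variable {k H R S : Type u} [Field k] [Ring H] [Ring R] [Ring S] [Bialgebra k H]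
  [Algebra k R] [Algebra k S]

variable (k R S) in
/-- A Morita context for `R` and `S`, with `f : P ⊗_R Q ≃ S` and `g : Q ⊗_S P ≃ R` isomorphisms
of bimodules. -/
structure MoritaContext where
  P : FDBimod k S R
  Q : FDBimod k R S
  f : P.BalTensor Q ≃ₗ[S] S
  f_op_smul : ∀ (p : P) (q : Q) (s : S), f (P.balMk Q p (op s • q)) = f (P.balMk Q p q) * s
  g : Q.BalTensor P ≃ₗ[R] R
  g_op_smul : ∀ (q : Q) (p : P) (r : R), g (Q.balMk P q (op r • p)) = g (Q.balMk P q p) * r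
  f_smul : ∀ (p : P) (q : Q) (p' : P), f (P.balMk Q p q) • p' = op (g (Q.balMk P q p')) • p
  g_smul : ∀ (q : Q) (p : P) (q' : Q), g (Q.balMk P q p) • q' = op (f (P.balMk Q p q')) • q

namespace MoritaContext

variable (M : MoritaContext k R S)

/-- The bilinear map `(p, q) ↦ f (p ⊗ q)`. -/
def fBilin : M.P →ₗ[k] M.Q →ₗ[k] S := (M.P.balMk M.Q).compr₂ (M.f.toLinearMap.restrictScalars k)

/-- The bilinear map `(q, p) ↦ g (q ⊗ p)`. -/
def gBilin : M.Q →ₗ[k] M.P →ₗ[k] R := (M.Q.balMk M.P).compr₂ (M.g.toLinearMap.restrictScalars k)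

end MoritaContext

variable [LeftComoduleAlgebra k H R] [LeftComoduleAlgebra k H S]

variable (k H R S) in
/-- An equivariant Morita context: a Morita context `(P, Q, f, g)` together with a coaction making
`P` an equivariant bimodule. -/
structure EquivMoritaContext extends MoritaContext k R S where
  coaction : P →ₗ[k] H ⊗[k] P
  isEquivariant : IsEquivariantCoaction P coaction

namespace EquivMoritaContext

/-- The equivariant bimodule `P`. -/
def equivBimod (M : EquivMoritaContext k H R S) : EquivBimod k H S R where
  bimod := M.P
  coaction := M.coaction
  isEquivariant := M.isEquivariant

/-- The functor `P ⊗_R -`, with `c (p ⊗ x ⊗ v) = p₋₁ • x ⊗ (p₀ ⊗ v)`. -/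
def moduleFunctor (M : EquivMoritaContext k H R S) :
    OplaxModuleFunctor k (FDMod k H) (FDMod k R) (FDMod k S) :=
  M.equivBimod.moduleFunctor

/-- Two equivariant Morita contexts are isomorphic if there are isomorphisms `u : P ≃ P'` of
equivariant bimodules and `v : Q ≃ Q'` of bimodules that are compatible with `f`, `f'` and
with `g`, `g'`. -/
def IsIsomorphic (M M' : EquivMoritaContext k H R S) : Prop :=
  ∃ (u : M.P ≃ₗ[k] M'.P) (v : M.Q ≃ₗ[k] M'.Q),
    (∀ (s : S) (p : M.P), u (s • p) = s • u p) ∧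
    (∀ (r : R) (p : M.P), u (op r • p) = op r • u p) ∧
    (∀ p : M.P, M'.coaction (u p) = u.toLinearMap.lTensor H (M.coaction p)) ∧
    (∀ (r : R) (q : M.Q), v (r • q) = r • v q) ∧
    (∀ (s : S) (q : M.Q), v (op s • q) = op s • v q) ∧
    (∀ (p : M.P) (q : M.Q), M'.fBilin (u p) (v q) = M.fBilin p q) ∧
    (∀ (q : M.Q) (p : M.P), M'.gBilin (v q) (u p) = M.gBilin q p)

variable (k H R S) in
/-- Isomorphism of equivariant Morita contexts. -/
instance isoSetoid : Setoid (EquivMoritaContext k H R S) where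
  r := IsIsomorphic
  iseqv :=
    { refl := fun M => ⟨LinearEquiv.refl k _, LinearEquiv.refl k _, by simp⟩
      symm := by
        rintro M M' ⟨u, v, h1, h2, h3, h4, h5, h6, h7⟩
        refine ⟨u.symm, v.symm, fun s p => ?_, fun r p => ?_, fun p => ?_, fun r q => ?_,
          fun s q => ?_, fun p q => ?_, fun q p => ?_⟩
        · apply u.injective; simp [h1]
        · apply u.injective; simp [h2]
        · have := h3 (u.symm p)
          rw [u.apply_symm_apply] at this
          rw [this, ← LinearMap.comp_apply, ← LinearMap.lTensor_comp]
          simp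
        · apply v.injective; simp [h4]
        · apply v.injective; simp [h5]
        · simp [← h6]
        · simp [← h7]
      trans := by
        rintro M M' M'' ⟨u, v, h1, h2, h3, h4, h5, h6, h7⟩ ⟨u', v', h1', h2', h3', h4', h5', h6', h7'⟩
        refine ⟨u.trans u', v.trans v', fun s p => ?_, fun r p => ?_, fun p => ?_, fun r q => ?_,
          fun s q => ?_, fun p q => ?_, fun q p => ?_⟩
        · simp [h1, h1']
        · simp [h2, h2']
        · rw [LinearEquiv.trans_apply, h3', h3, LinearEquiv.coe_trans, LinearMap.lTensor_comp,
            LinearMap.comp_apply]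
        · simp [h4, h4']
        · simp [h5, h5']
        · simp [h6, h6']
        · simp [h7, h7'] }

/-- The `H`-coaction `ρ` on `Q` makes it an equivariant `(R, S)`-bimodule for which `f` and `g` are
morphisms of `H`-comodules. -/
structure IsDualCoaction (M : EquivMoritaContext k H R S) (ρ : M.Q →ₗ[k] H ⊗[k] M.Q) : Prop where
  isEquivariant : IsEquivariantCoaction M.Q ρ
  f_coact : ∀ (p : M.P) (q : M.Q), coact k H S (M.fBilin p q) =
    tensorBilin (LinearMap.mul k H) M.fBilin (M.coaction p) (ρ q)
  g_coact : ∀ (q : M.Q) (p : M.P), coact k H R (M.gBilin q p) =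
    tensorBilin (LinearMap.mul k H) M.gBilin (ρ q) (M.coaction p)

end EquivMoritaContext

end Morita

end

end HopfModCat

open HopfModCat

/-!
Morita theory for comodule algebras rests on the fact that in a Morita context `(P, Q, f, g)` the
bimodule `Q` is the dual of `P`, so that everything is determined by `P`.

*The dual coaction.* For the pairing `f : P × Q → S` to be colinear, the coaction on `Q` has to
satisfy `q₋₁ ⊗ f(p ⊗ q₀) = S(p₋₁) f(p₀ ⊗ q)₋₁ ⊗ f(p₀ ⊗ q)₀`, `S(h)` denoting the antipode. The right
side is left linear in `p` over the comodule algebra (`dualPairing_smul`), and `f` is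
nondegenerate, so the condition has exactly one solution. An element `z` of `H ⊗ Q` is determined
by the products `p₋₁ z₋₁ ⊗ f(p₀ ⊗ z₀)` (`eq_of_forall_coactPairing_eq`), because convolution with
the coaction of `P` is inverted by convolution with its antipode. Pairing with `P` in this way turns
coassociativity, counitality and linearity of the coaction on `Q` into the corresponding properties
of the comodule algebras (`isDualCoaction_of_coact_fBilin`).

*From contexts to equivalences.* With the dual coaction, `q ⊗ p ⊗ v ↦ g(q ⊗ p) v` is an isomorphism
`Q ⊗_S (P ⊗_R V) ≅ V` compatible with the structure of module functors (`Contraction.idIso`), and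
likewise with the roles of `P` and `Q` exchanged. This already forces the transformations `c` of
both functors to be invertible (`OplaxModuleFunctor.isModuleFunctor_of_iso`), without reference to
the inverse of the antipode.

*Injectivity.* An isomorphism `P ⊗_R - ≅ P' ⊗_R -` of module functors gives at the regular module
`R` an isomorphism `P ≃ P'` of equivariant bimodules; colinearity is the compatibility with `c` at
the module `H ⊗ R` (`EquivBimod.exists_isBimodIso`). It extends to the duals `Q ≃ Q'`
(`MoritaContext.exists_equiv_of_equiv`).

*Surjectivity.* For an equivalence `F` put `P = F R`, on which `R` acts by functoriality. The map
`F R → F (H ⊗ R) → H ⊗ F R`, the image of the coaction of `R` followed by `c`, is a coaction, by the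
coherence of `c` (`isEquivariant_regCoaction`). Since `F` is an equivalence, `P` is a progenerator
with opposite endomorphism algebra `R` (`isProgenerator_regBimod`), so `P` and `Hom_S(P, S)` form a
Morita context. The evaluation map `P ⊗_R V ⟶ F V`, `p ⊗ v ↦ F(r ↦ r v)(p)`, is an isomorphism of
module functors (`wattsIso`).
-/

namespace HopfModCat

noncomputable section

open HopfModCat.LeftComoduleAlgebra (coact)

/-! ### Convolution with a coaction -/

/-- `ρ` is a coassociative and counital left `H`-coaction on the vector space `P`. -/
structure IsCoaction {k H P : Type*} [Field k] [AddCommGroup H] [Module k H] [Coalgebra k H]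
    [AddCommGroup P] [Module k P] (ρ : P →ₗ[k] H ⊗[k] P) : Prop where
  coassoc : (TensorProduct.assoc k H H P).toLinearMap ∘ₗ
    (Coalgebra.comul (R := k) (A := H)).rTensor P ∘ₗ ρ = ρ.lTensor H ∘ₗ ρ
  counit_coact : (TensorProduct.lid k P).toLinearMap ∘ₗ
    (Coalgebra.counit (R := k) (A := H)).rTensor P ∘ₗ ρ = LinearMap.id

section Convolution

variable {k H P E : Type*} [Field k] [Ring H] [AddCommGroup P] [Module k P]
  [AddCommGroup E] [Module k E] [Module H E]

/-- For `D : P → E` with values in an `H`-module, the map `H ⊗ P → E`, `h ⊗ p ↦ φ h • D p`. -/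
def actThrough [Algebra k H] [IsScalarTower k H E] (φ : H →ₗ[k] H) (D : P →ₗ[k] E) :
    H ⊗[k] P →ₗ[k] E :=
  TensorProduct.lift (((Algebra.lsmul k k E).toLinearMap ∘ₗ φ).compl₂ D)

@[simp]
theorem actThrough_tmul [Algebra k H] [IsScalarTower k H E] (φ : H →ₗ[k] H) (D : P →ₗ[k] E)
    (h : H) (p : P) : actThrough φ D (h ⊗ₜ p) = φ h • D p := rfl

/-- Convolution of `D : P → E` with the coaction `ρ`: the map `p ↦ p₋₁ • D p₀`. -/
def conv [Algebra k H] [IsScalarTower k H E] (ρ : P →ₗ[k] H ⊗[k] P) (D : P →ₗ[k] E) : P →ₗ[k] E :=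
  actThrough LinearMap.id D ∘ₗ ρ

/-- Convolution of `D : P → E` with the antipode of the coaction `ρ`: the map
`p ↦ S(p₋₁) • D p₀`. -/
def antipodeConv [HopfAlgebra k H] [IsScalarTower k H E] (ρ : P →ₗ[k] H ⊗[k] P) (D : P →ₗ[k] E) :
    P →ₗ[k] E :=
  actThrough (HopfAlgebra.antipode k) D ∘ₗ ρ

/-- Two successive convolutions amount to one: if `φ ⋆ ψ = ε` then
`φ(p₋₂) • ψ(p₋₁) • D p₀ = D p`. -/
theorem actThrough_actThrough [Bialgebra k H] [IsScalarTower k H E] {ρ : P →ₗ[k] H ⊗[k] P}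
    (hρ : IsCoaction ρ) {φ ψ : H →ₗ[k] H}
    (h : ∀ a : H, LinearMap.mul' k H (TensorProduct.map φ ψ (Coalgebra.comul a)) =
      algebraMap k H (Coalgebra.counit a)) (D : P →ₗ[k] E) :
    actThrough φ (actThrough ψ D ∘ₗ ρ) ∘ₗ ρ = D := by
  let Ω : H ⊗[k] (H ⊗[k] P) →ₗ[k] E := actThrough φ (actThrough ψ D)
  have h1 : actThrough φ (actThrough ψ D ∘ₗ ρ) = Ω ∘ₗ ρ.lTensor H :=
    TensorProduct.ext' fun a p => rfl
  have h2 : Ω ∘ₗ (TensorProduct.assoc k H H P).toLinearMap ∘ₗ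
      (Coalgebra.comul (R := k) (A := H)).rTensor P =
      D ∘ₗ (TensorProduct.lid k P).toLinearMap ∘ₗ
        (Coalgebra.counit (R := k) (A := H)).rTensor P := by
    refine TensorProduct.ext' fun a p => ?_
    have h3 : ∀ u : H ⊗[k] H, Ω (TensorProduct.assoc k H H P (u ⊗ₜ p)) =
        LinearMap.mul' k H (TensorProduct.map φ ψ u) • D p := by
      intro u
      induction u with
      | zero => simp
      | add s t hs ht => simp only [TensorProduct.add_tmul, map_add, add_smul, hs, ht]
      | tmul a b => simp [Ω, mul_smul]
    simp [h3, h]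
  calc actThrough φ (actThrough ψ D ∘ₗ ρ) ∘ₗ ρ = Ω ∘ₗ (ρ.lTensor H ∘ₗ ρ) := by
        rw [h1, LinearMap.comp_assoc]
    _ = (Ω ∘ₗ (TensorProduct.assoc k H H P).toLinearMap ∘ₗ
        (Coalgebra.comul (R := k) (A := H)).rTensor P) ∘ₗ ρ := by
        rw [← hρ.coassoc]; simp only [LinearMap.comp_assoc]
    _ = D ∘ₗ ((TensorProduct.lid k P).toLinearMap ∘ₗ
        (Coalgebra.counit (R := k) (A := H)).rTensor P ∘ₗ ρ) := by
        rw [h2]; simp only [LinearMap.comp_assoc]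
    _ = D := by rw [hρ.counit_coact, LinearMap.comp_id]

theorem conv_antipodeConv [HopfAlgebra k H] [IsScalarTower k H E] {ρ : P →ₗ[k] H ⊗[k] P}
    (hρ : IsCoaction ρ) (D : P →ₗ[k] E) : conv ρ (antipodeConv ρ D) = D :=
  actThrough_actThrough hρ (fun a => HopfAlgebra.mul_antipode_lTensor_comul_apply (R := k) a) D

theorem antipodeConv_conv [HopfAlgebra k H] [IsScalarTower k H E] {ρ : P →ₗ[k] H ⊗[k] P}
    (hρ : IsCoaction ρ) (D : P →ₗ[k] E) : antipodeConv ρ (conv ρ D) = D :=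
  actThrough_actThrough hρ (fun a => HopfAlgebra.mul_antipode_rTensor_comul_apply (R := k) a) D

end Convolution

section Cancel

variable {k H P N T : Type*} [Field k] [Ring H] [AddCommGroup P] [Module k P]
  [AddCommGroup N] [Module k N] [AddCommGroup T] [Module k T]

/-- A bilinear pairing `β` that is nondegenerate in its second variable stays so after tensoring
that variable with a vector space. -/
theorem eq_of_forall_lTensor_eq {k H P N T : Type*} [Field k] [AddCommGroup H] [Module k H]
    [AddCommGroup P] [Module k P] [AddCommGroup N] [Module k N] [AddCommGroup T] [Module k T]
    {β : P →ₗ[k] N →ₗ[k] T} (hβ : ∀ n, (∀ p, β p n = 0) → n = 0) {z w : H ⊗[k] N}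
    (h : ∀ p, (β p).lTensor H z = (β p).lTensor H w) : z = w := by
  classical
  let b := Module.Basis.ofVectorSpace k H
  rw [← sub_eq_zero]
  refine (TensorProduct.equivFinsuppOfBasisLeft b).injective (Finsupp.ext fun i => ?_)
  rw [map_zero, Finsupp.zero_apply]
  refine hβ _ fun p => ?_
  have key : ∀ u : H ⊗[k] N, β p (TensorProduct.equivFinsuppOfBasisLeft b u i) =
      TensorProduct.equivFinsuppOfBasisLeft b ((β p).lTensor H u) i := by
    intro u
    induction u with
    | zero => simp
    | add s t hs ht => simp only [map_add, Finsupp.add_apply, hs, ht]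
    | tmul a n => simp
  rw [key, map_sub, h p, sub_self, map_zero, Finsupp.zero_apply]

/-- The pairing `(h ⊗ p, h' ⊗ n) ↦ h h' ⊗ β p n` induced by `β`, evaluated on `ρ p = p₋₁ ⊗ p₀`. -/
def coactPairing [Algebra k H] (ρ : P →ₗ[k] H ⊗[k] P) (β : P →ₗ[k] N →ₗ[k] T) :
    P →ₗ[k] H ⊗[k] N →ₗ[k] H ⊗[k] T :=
  tensorBilin (LinearMap.mul k H) β ∘ₗ ρ

theorem tensorBilin_mul_tmul [Algebra k H] (β : P →ₗ[k] N →ₗ[k] T) (h : H) (p : P)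
    (z : H ⊗[k] N) :
    tensorBilin (LinearMap.mul k H) β (h ⊗ₜ p) z = h • (β p).lTensor H z := by
  induction z with
  | zero => simp
  | add s t hs ht => simp only [map_add, smul_add, hs, ht]
  | tmul a n => rfl

theorem coactPairing_eq_conv [Algebra k H] (ρ : P →ₗ[k] H ⊗[k] P) (β : P →ₗ[k] N →ₗ[k] T)
    (z : H ⊗[k] N) :
    (coactPairing ρ β).flip z =
      conv ρ ((LinearMap.applyₗ z) ∘ₗ (LinearMap.lTensorHom H) ∘ₗ β) := by
  ext p
  simp only [coactPairing, conv, LinearMap.flip_apply, LinearMap.comp_apply]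
  induction ρ p with
  | zero => simp
  | add s t hs ht => simp only [map_add, LinearMap.add_apply, hs, ht]
  | tmul h p => simp [tensorBilin_mul_tmul]

/-- An element `z` of `H ⊗ N` is determined by the values `p₋₁ z₋₁ ⊗ β p₀ z₀`, because the
antipode recovers the values `z₋₁ ⊗ β p z₀` from them. -/
theorem eq_of_forall_coactPairing_eq [HopfAlgebra k H] {ρ : P →ₗ[k] H ⊗[k] P} (hρ : IsCoaction ρ)
    {β : P →ₗ[k] N →ₗ[k] T} (hβ : ∀ n, (∀ p, β p n = 0) → n = 0) {z w : H ⊗[k] N}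
    (h : ∀ p, coactPairing ρ β p z = coactPairing ρ β p w) : z = w := by
  refine eq_of_forall_lTensor_eq hβ fun p => ?_
  have h1 : (coactPairing ρ β).flip z = (coactPairing ρ β).flip w := LinearMap.ext h
  rw [coactPairing_eq_conv, coactPairing_eq_conv] at h1
  have h2 := congrArg (antipodeConv ρ) h1
  rw [antipodeConv_conv hρ, antipodeConv_conv hρ] at h2
  exact LinearMap.congr_fun h2 p

end Cancel

/-! ### Calculus of pairings with values in a tensor product -/

section TensorPairing

variable {k H A B C U V W : Type*} [Field k] [Ring H]
  [AddCommGroup A] [Module k A] [AddCommGroup B] [Module k B] [AddCommGroup C] [Module k C]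
  [AddCommGroup U] [Module k U] [AddCommGroup V] [Module k V] [AddCommGroup W] [Module k W]

theorem tensorBilin_assoc [Algebra k H] {β₁ : A →ₗ[k] B →ₗ[k] U} {β₂ : U →ₗ[k] C →ₗ[k] W}
    {γ₁ : A →ₗ[k] V →ₗ[k] W} {γ₂ : B →ₗ[k] C →ₗ[k] V}
    (h : ∀ a b c, β₂ (β₁ a b) c = γ₁ a (γ₂ b c)) (x : H ⊗[k] A) (y : H ⊗[k] B) (z : H ⊗[k] C) :
    tensorBilin (LinearMap.mul k H) β₂ (tensorBilin (LinearMap.mul k H) β₁ x y) z =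
      tensorBilin (LinearMap.mul k H) γ₁ x (tensorBilin (LinearMap.mul k H) γ₂ y z) := by
  induction x with
  | zero => simp
  | add s t hs ht => simp only [map_add, LinearMap.add_apply, hs, ht]
  | tmul a x =>
    induction y with
    | zero => simp
    | add s t hs ht => simp only [map_add, LinearMap.add_apply, hs, ht]
    | tmul b y =>
      induction z with
      | zero => simp
      | add s t hs ht => simp only [map_add, hs, ht]
      | tmul c z => simp [h, mul_assoc]

theorem tensorBilin_mul_mul {K : Type*} [Ring K] [Algebra k K] [Algebra k H] (x y : H ⊗[k] K) :
    tensorBilin (LinearMap.mul k H) (LinearMap.mul k K) x y = x * y := by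
  induction x with
  | zero => simp
  | add s t hs ht => simp only [map_add, LinearMap.add_apply, hs, ht, add_mul]
  | tmul a x =>
    induction y with
    | zero => simp
    | add s t hs ht => simp only [map_add, hs, ht, mul_add]
    | tmul b y => simp

theorem smul_tensor_mul {K : Type*} [Ring K] [Algebra k K] [Algebra k H] (h : H)
    (x y : H ⊗[k] K) : h • x * y = h • (x * y) := by
  induction x with
  | zero => simp
  | add s t hs ht => simp only [smul_add, add_mul, hs, ht]
  | tmul a x =>
    induction y with
    | zero => simp
    | add s t hs ht => simp only [smul_add, mul_add, hs, ht]
    | tmul b y => simp [TensorProduct.smul_tmul', mul_assoc]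

theorem tensorBilin_comp_left [Algebra k H] (γ : V →ₗ[k] B →ₗ[k] C) (ρ : A →ₗ[k] V)
    (x : H ⊗[k] A) (y : H ⊗[k] B) :
    tensorBilin (LinearMap.mul k H) (γ ∘ₗ ρ) x y =
      tensorBilin (LinearMap.mul k H) γ (ρ.lTensor H x) y := by
  induction x with
  | zero => simp
  | add s t hs ht => simp only [map_add, LinearMap.add_apply, hs, ht]
  | tmul a x => simp [tensorBilin_mul_tmul]

theorem lTensor_tensorBilin [Algebra k H] {β : A →ₗ[k] B →ₗ[k] C} {ρA : A →ₗ[k] H ⊗[k] A}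
    {ρB : B →ₗ[k] H ⊗[k] B} {ρC : C →ₗ[k] H ⊗[k] C}
    (h : ∀ a b, ρC (β a b) = tensorBilin (LinearMap.mul k H) β (ρA a) (ρB b))
    (x : H ⊗[k] A) (y : H ⊗[k] B) :
    ρC.lTensor H (tensorBilin (LinearMap.mul k H) β x y) =
      tensorBilin (LinearMap.mul k H) (tensorBilin (LinearMap.mul k H) β)
        (ρA.lTensor H x) (ρB.lTensor H y) := by
  induction x with
  | zero => simp
  | add s t hs ht => simp only [map_add, LinearMap.add_apply, hs, ht]
  | tmul a x =>
    induction y with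
    | zero => simp
    | add s t hs ht => simp only [map_add, hs, ht]
    | tmul b y => simp [h]

theorem comul_rTensor_tensorBilin [Bialgebra k H] (β : A →ₗ[k] B →ₗ[k] C)
    (x : H ⊗[k] A) (y : H ⊗[k] B) :
    TensorProduct.assoc k H H C ((Coalgebra.comul (R := k) (A := H)).rTensor C
        (tensorBilin (LinearMap.mul k H) β x y)) =
      tensorBilin (LinearMap.mul k H) (tensorBilin (LinearMap.mul k H) β)
        (TensorProduct.assoc k H H A ((Coalgebra.comul (R := k) (A := H)).rTensor A x))
        (TensorProduct.assoc k H H B ((Coalgebra.comul (R := k) (A := H)).rTensor B y)) := by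
  induction x with
  | zero => simp
  | add s t hs ht => simp only [map_add, LinearMap.add_apply, hs, ht]
  | tmul a x =>
    induction y with
    | zero => simp
    | add s t hs ht => simp only [map_add, hs, ht]
    | tmul b y =>
      simp only [tensorBilin_tmul, LinearMap.mul_apply', LinearMap.rTensor_tmul,
        Bialgebra.comul_mul]
      generalize Coalgebra.comul (R := k) a = u
      generalize Coalgebra.comul (R := k) b = v
      induction u with
      | zero => simp
      | add s t hs ht =>
        simp only [map_add, LinearMap.add_apply, TensorProduct.add_tmul, add_mul, hs, ht]
      | tmul a a' =>
        induction v with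
        | zero => simp
        | add s t hs ht => simp only [map_add, TensorProduct.add_tmul, mul_add, hs, ht]
        | tmul b b' => simp

theorem counit_rTensor_tensorBilin [Bialgebra k H] (β : A →ₗ[k] B →ₗ[k] C)
    (x : H ⊗[k] A) (y : H ⊗[k] B) :
    TensorProduct.lid k C ((Coalgebra.counit (R := k) (A := H)).rTensor C
        (tensorBilin (LinearMap.mul k H) β x y)) =
      β (TensorProduct.lid k A ((Coalgebra.counit (R := k) (A := H)).rTensor A x))
        (TensorProduct.lid k B ((Coalgebra.counit (R := k) (A := H)).rTensor B y)) := by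
  induction x with
  | zero => simp
  | add s t hs ht => simp only [map_add, LinearMap.add_apply, hs, ht]
  | tmul a x =>
    induction y with
    | zero => simp
    | add s t hs ht => simp only [map_add, hs, ht]
    | tmul b y =>
      simp only [tensorBilin_tmul, LinearMap.mul_apply', LinearMap.rTensor_tmul,
        TensorProduct.lid_tmul, Bialgebra.counit_mul, map_smul, LinearMap.smul_apply, mul_smul]
      exact smul_comm _ _ _

end TensorPairing

/-! ### Morita contexts -/

namespace MoritaContext

variable {k R S : Type u} [Field k] [Ring R] [Ring S] [Algebra k R] [Algebra k S]
  (M : MoritaContext k R S)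

/-- The Morita context `(Q, P, g, f)`, with the roles of `R` and `S` exchanged. -/
def symm : MoritaContext k S R :=
  ⟨M.Q, M.P, M.g, M.g_op_smul, M.f, M.f_op_smul, M.g_smul, M.f_smul⟩

theorem fBilin_smul_left (s : S) (p : M.P) (q : M.Q) :
    M.fBilin (s • p) q = s * M.fBilin p q := M.f.map_smul s (M.P.balMk M.Q p q)

theorem fBilin_op_smul_left (r : R) (p : M.P) (q : M.Q) :
    M.fBilin (op r • p) q = M.fBilin p (r • q) := congrArg M.f (M.P.balMk_smul p r q)

theorem fBilin_op_smul_right (s : S) (p : M.P) (q : M.Q) :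
    M.fBilin p (op s • q) = M.fBilin p q * s := M.f_op_smul p q s

theorem fBilin_smul (p : M.P) (q : M.Q) (p' : M.P) :
    M.fBilin p q • p' = op (M.gBilin q p') • p := M.f_smul p q p'

theorem gBilin_smul_left (r : R) (q : M.Q) (p : M.P) :
    M.gBilin (r • q) p = r * M.gBilin q p := M.symm.fBilin_smul_left r q p

theorem gBilin_op_smul_left (s : S) (q : M.Q) (p : M.P) :
    M.gBilin (op s • q) p = M.gBilin q (s • p) := M.symm.fBilin_op_smul_left s q p

theorem gBilin_op_smul_right (r : R) (q : M.Q) (p : M.P) :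
    M.gBilin q (op r • p) = M.gBilin q p * r := M.symm.fBilin_op_smul_right r q p

theorem gBilin_smul (q : M.Q) (p : M.P) (q' : M.Q) :
    M.gBilin q p • q' = op (M.fBilin p q') • q := M.symm.fBilin_smul q p q'

theorem exists_sum_fBilin_eq_one :
    ∃ (n : ℕ) (p : Fin n → M.P) (q : Fin n → M.Q), ∑ i, M.fBilin (p i) (q i) = 1 := by
  obtain ⟨x, hx⟩ := M.f.surjective 1
  obtain ⟨t, rfl⟩ := (M.P.balRel M.Q).mkQ_surjective x
  obtain ⟨n, p, q, rfl⟩ := TensorProduct.exists_sum_tmul_eq t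
  simp only [map_sum] at hx
  exact ⟨n, p, q, hx⟩

theorem exists_sum_gBilin_eq_one :
    ∃ (n : ℕ) (q : Fin n → M.Q) (p : Fin n → M.P), ∑ i, M.gBilin (q i) (p i) = 1 :=
  M.symm.exists_sum_fBilin_eq_one

theorem eq_zero_of_fBilin_eq_zero {q : M.Q} (h : ∀ p, M.fBilin p q = 0) : q = 0 := by
  obtain ⟨n, x, y, hxy⟩ := M.exists_sum_gBilin_eq_one
  rw [← one_smul R q, ← hxy, Finset.sum_smul]
  exact Finset.sum_eq_zero fun i _ => by rw [gBilin_smul, h, op_zero, zero_smul]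

theorem eq_zero_of_op_smul_eq_zero {r : R} (h : ∀ p : M.P, op r • p = 0) : r = 0 := by
  obtain ⟨n, x, y, hxy⟩ := M.exists_sum_gBilin_eq_one
  rw [← one_mul r, ← hxy, Finset.sum_mul]
  exact Finset.sum_eq_zero fun i _ => by rw [← gBilin_op_smul_right, h, map_zero]

end MoritaContext

/-! ### The dual coaction -/

namespace EquivMoritaContext

variable {k H R S : Type u} [Field k] [Ring H] [Ring R] [Ring S] [HopfAlgebra k H]
  [Algebra k R] [Algebra k S] [LeftComoduleAlgebra k H R] [LeftComoduleAlgebra k H S]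
  (M : EquivMoritaContext k H R S)

theorem isCoaction : IsCoaction M.coaction :=
  ⟨M.isEquivariant.coassoc, M.isEquivariant.counit_coact⟩

/-- The bilinear map `(p, q) ↦ f(p ⊗ q)₋₁ ⊗ f(p ⊗ q)₀`. -/
def coactF : M.P →ₗ[k] M.Q →ₗ[k] H ⊗[k] S := M.fBilin.compr₂ (coact k H S).toLinearMap

/-- The bilinear map `(p, q) ↦ S(p₋₁) f(p₀ ⊗ q)₋₁ ⊗ f(p₀ ⊗ q)₀`. A dual coaction on `Q` has to send
`q` to the element `z` with `z₋₁ ⊗ f (p ⊗ z₀)` equal to this for all `p`. -/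
def dualPairing : M.P →ₗ[k] M.Q →ₗ[k] H ⊗[k] S := antipodeConv M.coaction M.coactF

theorem antipode_coact (s : S) :
    actThrough (HopfAlgebra.antipode k) (coact k H S).toLinearMap (coact k H S s) =
      (1 : H) ⊗ₜ[k] s := by
  have h1 : IsCoaction (coact k H S).toLinearMap :=
    ⟨LeftComoduleAlgebra.coassoc, LeftComoduleAlgebra.counit_coact⟩
  have h2 : (coact k H S).toLinearMap =
      conv (coact k H S).toLinearMap (TensorProduct.mk k H S 1) := by
    ext s
    simp only [conv, LinearMap.comp_apply, AlgHom.toLinearMap_apply]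
    induction coact k H S s with
    | zero => simp
    | add a b ha hb => rw [map_add, ← ha, ← hb]
    | tmul h s => simp [TensorProduct.smul_tmul']
  have h3 := LinearMap.congr_fun (antipodeConv_conv h1 (TensorProduct.mk k H S (1 : H))) s
  rw [← h2] at h3
  exact h3

theorem dualPairing_smul (s : S) (p : M.P) (q : M.Q) :
    M.dualPairing (s • p) q = ((1 : H) ⊗ₜ[k] s) * M.dualPairing p q := by
  have key : ∀ (h : H) (p : M.P) (x : H ⊗[k] S), actThrough (HopfAlgebra.antipode k) M.coactF
      (tensorBilin (LinearMap.mul k H) (Algebra.lsmul k k M.P).toLinearMap x (h ⊗ₜ p)) q =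
      HopfAlgebra.antipode k h •
        (actThrough (HopfAlgebra.antipode k) (coact k H S).toLinearMap x * M.coactF p q) := by
    intro h p x
    induction x with
    | zero => simp
    | add a b ha hb => simp only [map_add, LinearMap.add_apply, ha, hb, add_mul, smul_add]
    | tmul a s =>
      simp [coactF, HopfAlgebra.antipode_mul_antidistrib, mul_smul, M.fBilin_smul_left,
        smul_tensor_mul]
  rw [dualPairing, antipodeConv, LinearMap.comp_apply, LinearMap.comp_apply,
    M.isEquivariant.map_smul]
  induction M.coaction p with
  | zero => simp
  | add a b ha hb => simp only [map_add, LinearMap.add_apply, ha, hb, mul_add]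
  | tmul h p =>
    rw [key, antipode_coact]
    simp only [actThrough_tmul, LinearMap.smul_apply]
    generalize M.coactF p q = w
    induction w with
    | zero => simp
    | add a b ha hb => simp only [mul_add, smul_add, ha, hb]
    | tmul b t => simp [TensorProduct.smul_tmul']

theorem exists_lTensor_fBilin_eq_dualPairing :
    ∃ ρ : M.Q →ₗ[k] H ⊗[k] M.Q, ∀ p q, (M.fBilin p).lTensor H (ρ q) = M.dualPairing p q := by
  obtain ⟨n, x, y, hxy⟩ := M.exists_sum_gBilin_eq_one
  -- Since `q = ∑ xᵢ f(yᵢ ⊗ q)`, the value of `ρ` at `q` can be read off from `dualPairing yᵢ q`.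
  refine ⟨∑ i, (M.Q.rightAct (x i)).lTensor H ∘ₗ M.dualPairing (y i), fun p q => ?_⟩
  have h1 : ∀ i (z : H ⊗[k] S), (M.fBilin p).lTensor H ((M.Q.rightAct (x i)).lTensor H z) =
      ((1 : H) ⊗ₜ[k] M.fBilin p (x i)) * z := by
    intro i z
    induction z with
    | zero => simp
    | add a b ha hb => simp only [map_add, mul_add, ha, hb]
    | tmul h s => simp [M.fBilin_op_smul_right]
  have h2 : ∑ i, M.fBilin p (x i) • y i = p := by
    simp only [M.fBilin_smul, ← Finset.sum_smul, ← Finset.op_sum, hxy, op_one, one_smul]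
  simp only [LinearMap.sum_apply, LinearMap.comp_apply, map_sum, h1, ← dualPairing_smul]
  rw [← LinearMap.sum_apply, ← map_sum, h2]

/-- A coaction on `Q` for which `f` is a morphism of comodules is determined by `f` and the coaction
on `P`. -/
theorem eq_of_coact_fBilin {z w : H ⊗[k] M.Q}
    (h : ∀ p, tensorBilin (LinearMap.mul k H) M.fBilin (M.coaction p) z =
      tensorBilin (LinearMap.mul k H) M.fBilin (M.coaction p) w) : z = w :=
  eq_of_forall_coactPairing_eq M.isCoaction (fun _ => M.eq_zero_of_fBilin_eq_zero) h

theorem exists_coact_fBilin : ∃ ρ : M.Q →ₗ[k] H ⊗[k] M.Q, ∀ (p : M.P) (q : M.Q),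
    coact k H S (M.fBilin p q) =
      tensorBilin (LinearMap.mul k H) M.fBilin (M.coaction p) (ρ q) := by
  obtain ⟨ρ, hρ⟩ := M.exists_lTensor_fBilin_eq_dualPairing
  refine ⟨ρ, fun p q => ?_⟩
  have h1 := LinearMap.congr_fun (LinearMap.congr_fun
    (conv_antipodeConv M.isCoaction M.coactF) p) q
  have h2 := LinearMap.congr_fun (coactPairing_eq_conv M.coaction M.fBilin (ρ q)) p
  refine (h1.symm.trans ?_).trans h2.symm
  change actThrough LinearMap.id M.dualPairing (M.coaction p) q = actThrough _ _ (M.coaction p)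
  induction M.coaction p with
  | zero => simp
  | add a b ha hb => simp only [map_add, LinearMap.add_apply, ha, hb]
  | tmul h p => simp [hρ]

section ColinearPairing

variable {M} {ρ : M.Q →ₗ[k] H ⊗[k] M.Q}

theorem coassoc_of_coact_fBilin
    (hρ : ∀ (p : M.P) (q : M.Q), coact k H S (M.fBilin p q) =
      tensorBilin (LinearMap.mul k H) M.fBilin (M.coaction p) (ρ q)) :
    (TensorProduct.assoc k H H M.Q).toLinearMap ∘ₗ
    (Coalgebra.comul (R := k) (A := H)).rTensor M.Q ∘ₗ ρ = ρ.lTensor H ∘ₗ ρ := by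
  ext q
  have hβ : ∀ z : H ⊗[k] M.Q, (∀ p, coactPairing M.coaction M.fBilin p z = 0) → z = 0 :=
    fun z hz => M.eq_of_coact_fBilin fun p => (hz p).trans (map_zero _).symm
  refine eq_of_forall_coactPairing_eq M.isCoaction hβ fun p => ?_
  have h1 := LinearMap.congr_fun M.isEquivariant.coassoc p
  have h2 := LinearMap.congr_fun (LeftComoduleAlgebra.coassoc (k := k) (H := H) (K := S))
    (M.fBilin p q)
  simp only [LinearMap.comp_apply, LinearEquiv.coe_coe, AlgHom.toLinearMap_apply] at h1 h2 ⊢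
  simp only [coactPairing, LinearMap.comp_apply, tensorBilin_comp_left]
  rw [← lTensor_tensorBilin (ρC := (coact k H S).toLinearMap) hρ, ← hρ, ← h2, hρ,
    comul_rTensor_tensorBilin, h1]

theorem counit_of_coact_fBilin
    (hρ : ∀ (p : M.P) (q : M.Q), coact k H S (M.fBilin p q) =
      tensorBilin (LinearMap.mul k H) M.fBilin (M.coaction p) (ρ q)) :
    (TensorProduct.lid k M.Q).toLinearMap ∘ₗ
    (Coalgebra.counit (R := k) (A := H)).rTensor M.Q ∘ₗ ρ = LinearMap.id := by
  ext q
  rw [← sub_eq_zero]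
  refine M.eq_zero_of_fBilin_eq_zero fun p => ?_
  have h1 := LinearMap.congr_fun M.isEquivariant.counit_coact p
  have h2 := LinearMap.congr_fun (LeftComoduleAlgebra.counit_coact (k := k) (H := H) (K := S))
    (M.fBilin p q)
  simp only [LinearMap.comp_apply, LinearEquiv.coe_coe, AlgHom.toLinearMap_apply,
    LinearMap.id_apply] at h1 h2 ⊢
  rw [hρ, counit_rTensor_tensorBilin, h1] at h2
  rw [map_sub, h2, sub_self]

/-- A linear map `ρ : Q → H ⊗ Q` that makes `f` colinear is automatically a coaction, compatible
with the bimodule structure and with `g`. -/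
theorem isDualCoaction_of_coact_fBilin
    (hρ : ∀ (p : M.P) (q : M.Q), coact k H S (M.fBilin p q) =
      tensorBilin (LinearMap.mul k H) M.fBilin (M.coaction p) (ρ q)) :
    M.IsDualCoaction ρ where
  isEquivariant :=
    { coassoc := coassoc_of_coact_fBilin hρ
      counit_coact := counit_of_coact_fBilin hρ
      map_smul := fun r q => M.eq_of_coact_fBilin fun p => by
        rw [← hρ, ← M.fBilin_op_smul_left, hρ, M.isEquivariant.map_op_smul]
        exact tensorBilin_assoc (fun p r q => M.fBilin_op_smul_left r p q) _ _ _
      map_op_smul := fun q s => M.eq_of_coact_fBilin fun p => by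
        rw [← hρ, M.fBilin_op_smul_right, map_mul, hρ, ← tensorBilin_mul_mul]
        exact tensorBilin_assoc (fun p q s => (M.fBilin_op_smul_right s p q).symm) _ _ _ }
  f_coact := hρ
  g_coact := fun q p => by
    -- Both sides act in the same way on `P` from the right, since `p' g(q ⊗ p) = f(p' ⊗ q) p`.
    refine eq_of_forall_coactPairing_eq M.isCoaction (β := M.P.rightAct)
      (fun r => M.eq_zero_of_op_smul_eq_zero) fun p' => ?_
    refine (M.isEquivariant.map_op_smul p' (M.gBilin q p)).symm.trans ?_
    rw [← M.fBilin_smul, M.isEquivariant.map_smul, hρ]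
    exact tensorBilin_assoc (fun p' q p => M.fBilin_smul p' q p) _ _ _

end ColinearPairing

theorem existsUnique_isDualCoaction :
    ∃! ρ : M.Q →ₗ[k] H ⊗[k] M.Q, M.IsDualCoaction ρ := by
  obtain ⟨ρ, hρ⟩ := M.exists_coact_fBilin
  refine ⟨ρ, isDualCoaction_of_coact_fBilin hρ, fun ρ' h => LinearMap.ext fun q => ?_⟩
  exact M.eq_of_coact_fBilin fun p => by rw [← hρ, h.f_coact]

end EquivMoritaContext

/-! ### Isomorphisms of modules and of module functors -/

theorem FDMod.isIso_of_bijective {k A : Type u} [Field k] [Ring A] [Algebra k A] {V W : FDMod k A}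
    (f : V ⟶ W) (hf : Function.Bijective (FDMod.lin f)) : IsIso f :=
  (FDMod.isoMk (LinearEquiv.ofBijective (FDMod.klin f) hf)
    fun a m => (FDMod.lin f).map_smul a m).isIso_hom

namespace OplaxModuleFunctor

open MonoidalLeftAction CategoryTheory.Functor OplaxLeftLinear

universe v₁ v₂ v₃ w₁ w₂ w₃ w

variable {k : Type w} [Field k] {C : Type w₁} [Category.{v₁} C] [MonoidalCategory C]
  {D : Type w₂} [Category.{v₂} D] [MonoidalLeftAction C D]
  {D' : Type w₃} [Category.{v₃} D'] [MonoidalLeftAction C D']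
  [Preadditive D] [Preadditive D'] [CategoryTheory.Linear k D] [CategoryTheory.Linear k D']

/-- A morphism of module functors whose components are isomorphisms is an isomorphism. -/
def isoOfComponents {F G : OplaxModuleFunctor k C D D'} (α : F ⟶ G)
    [∀ V, IsIso (α.natTrans.app V)] : F ≅ G :=
  haveI : IsIso α.natTrans := NatIso.isIso_of_isIso_app _
  { hom := α
    inv := ⟨inv α.natTrans, fun X V => by
      rw [NatIso.isIso_inv_app, NatIso.isIso_inv_app, IsIso.inv_comp_eq, ← Category.assoc, α.comm,
        Category.assoc, ← actionHomRight_comp, IsIso.hom_inv_id, actionHomRight_id,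
        Category.comp_id]⟩
    hom_inv_id := Hom.ext (IsIso.hom_inv_id α.natTrans)
    inv_hom_id := Hom.ext (IsIso.inv_hom_id α.natTrans) }

/-- The natural isomorphism underlying an isomorphism of module functors. -/
def natIso {F G : OplaxModuleFunctor k C D D'} (α : F ≅ G) : F.functor ≅ G.functor where
  hom := α.hom.natTrans
  inv := α.inv.natTrans
  hom_inv_id := congrArg Hom.natTrans α.hom_inv_id
  inv_hom_id := congrArg Hom.natTrans α.inv_hom_id

theorem isEquivalence_functor {F : OplaxModuleFunctor k C D D'} {G : OplaxModuleFunctor k C D' D}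
    (a : id k C D ≅ F.comp G) (b : id k C D' ≅ G.comp F) : F.functor.IsEquivalence :=
  (CategoryTheory.Equivalence.mk F.functor G.functor (natIso a)
    (natIso b).symm).isEquivalence_functor

theorem isIso_δₗ_comp {F : OplaxModuleFunctor k C D D'} {G : OplaxModuleFunctor k C D' D}
    (a : id k C D ≅ F.comp G) (X : C) (V : D) :
    IsIso (G.functor.map (δₗ F.functor X V) ≫ δₗ G.functor X (F.functor.obj V)) := by
  have h : (natIso a).hom.app (X ⊙ₗ V) ≫
      (G.functor.map (δₗ F.functor X V) ≫ δₗ G.functor X (F.functor.obj V)) =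
      𝟙 _ ≫ X ⊴ₗ (natIso a).hom.app V := a.hom.comm X V
  rw [Category.id_comp] at h
  have h2 : IsIso (X ⊴ₗ (natIso a).hom.app V) := inferInstance
  rw [← h] at h2
  exact @IsIso.of_isIso_comp_left _ _ _ _ _ ((natIso a).hom.app (X ⊙ₗ V)) _ inferInstance h2

/-- If `F` and `G` are quasi-inverse to each other as functors with a coherent, not necessarily
invertible transformation, then these transformations are invertible. -/
theorem isModuleFunctor_of_iso {F : OplaxModuleFunctor k C D D'}
    {G : OplaxModuleFunctor k C D' D} (a : id k C D ≅ F.comp G) (b : id k C D' ≅ G.comp F) :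
    F.IsModuleFunctor := fun X V => by
  have := isEquivalence_functor a b
  have := isEquivalence_functor b a
  have h1 := isIso_δₗ_comp a X V
  have h2 := isIso_δₗ_comp b X (F.functor.obj V)
  have : Mono (F.functor.map (δₗ G.functor X (F.functor.obj V))) :=
    mono_of_mono _ (δₗ F.functor X (G.functor.obj (F.functor.obj V)))
  have : Mono (δₗ G.functor X (F.functor.obj V)) := F.functor.mono_of_mono_map this
  -- `δ_G` at `F V` is a monomorphism as well as a split epimorphism.
  have : IsSplitEpi (δₗ G.functor X (F.functor.obj V)) :=
    ⟨⟨⟨inv (G.functor.map (δₗ F.functor X V) ≫ δₗ G.functor X (F.functor.obj V)) ≫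
      G.functor.map (δₗ F.functor X V), by rw [Category.assoc, IsIso.inv_hom_id]⟩⟩⟩
  have : IsIso (δₗ G.functor X (F.functor.obj V)) := isIso_of_mono_of_isSplitEpi _
  have : IsIso (G.functor.map (δₗ F.functor X V)) :=
    IsIso.of_isIso_comp_right _ (δₗ G.functor X (F.functor.obj V))
  exact isIso_of_reflects_iso _ G.functor

theorem isModuleEquivalence_of_iso {F : OplaxModuleFunctor k C D D'}
    {G : OplaxModuleFunctor k C D' D} (a : id k C D ≅ F.comp G) (b : id k C D' ≅ G.comp F) :
    F.IsModuleEquivalence :=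
  ⟨isModuleFunctor_of_iso a b, G, isModuleFunctor_of_iso b a, ⟨a⟩, ⟨b⟩⟩

end OplaxModuleFunctor

/-! ### Maps out of balanced tensor products -/

namespace FDBimod

variable {k S R : Type u} [Field k] [Ring S] [Ring R] [Algebra k S] [Algebra k R]
  (P : FDBimod k S R) {V : Type u} [AddCommGroup V] [Module k V] [Module R V]

/-- The relations of `P ⊗_R V` are stable under `S`, so that they are spanned over `k`. -/
theorem balRel_le_span : ∀ t ∈ P.balRel V, t ∈ Submodule.span k
    {t : P ⊗[k] V | ∃ (p : P) (r : R) (v : V), t = (op r • p) ⊗ₜ v - p ⊗ₜ (r • v)} := by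
  intro t ht
  refine Submodule.span_induction (p := fun t _ => t ∈ Submodule.span k
    {t : P ⊗[k] V | ∃ (p : P) (r : R) (v : V), t = (op r • p) ⊗ₜ v - p ⊗ₜ (r • v)})
    (fun x hx => Submodule.subset_span hx) (Submodule.zero_mem _)
    (fun x y _ _ hx hy => Submodule.add_mem _ hx hy) (fun s x _ hx => ?_) ht
  refine (Submodule.span_le (p := Submodule.comap (Algebra.lsmul k k (P ⊗[k] V) s)
    (Submodule.span k {t : P ⊗[k] V | ∃ (p : P) (r : R) (v : V),
      t = (op r • p) ⊗ₜ v - p ⊗ₜ (r • v)}))).2 ?_ hx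
  rintro _ ⟨p, r, v, rfl⟩
  refine Submodule.subset_span ⟨s • p, r, v, ?_⟩
  refine (smul_sub s _ _).trans ?_
  rw [TensorProduct.smul_tmul', TensorProduct.smul_tmul', smul_comm]

variable {P} {W : Type*} [AddCommGroup W] [Module k W]

/-- The `k`-linear map `P ⊗_R V → W` induced by a balanced bilinear map. -/
def balDesc (b : P →ₗ[k] V →ₗ[k] W) (hb : ∀ (p : P) (r : R) (v : V), b (op r • p) v = b p (r • v)) :
    P.BalTensor V →ₗ[k] W :=
  Submodule.liftQ ((P.balRel V).restrictScalars k) (TensorProduct.lift b) (fun t ht => by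
    refine Submodule.span_le.2 ?_ (P.balRel_le_span t ht)
    rintro _ ⟨p, r, v, rfl⟩
    simp [hb]) ∘ₗ (Submodule.Quotient.restrictScalarsEquiv k (P.balRel V)).symm.toLinearMap

end FDBimod

namespace EquivBimod

variable {k H S R : Type u} [Field k] [Ring H] [Ring S] [Ring R] [Bialgebra k H]
  [Algebra k S] [Algebra k R] [LeftComoduleAlgebra k H S] [LeftComoduleAlgebra k H R]
  (P : EquivBimod k H S R)

/-- The `k`-linear map `P ⊗_R V → W` induced by a balanced bilinear map. -/
def tensorDescK {V : FDMod k R} {W : Type*} [AddCommGroup W] [Module k W]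
    (b : P.bimod →ₗ[k] V →ₗ[k] W)
    (hb : ∀ (p : P.bimod) (r : R) (v : V), b (op r • p) v = b p (r • v)) :
    P.tensorObj V →ₗ[k] W :=
  FDBimod.balDesc b hb

@[simp]
theorem tensorDescK_tmk {V : FDMod k R} {W : Type*} [AddCommGroup W] [Module k W]
    (b : P.bimod →ₗ[k] V →ₗ[k] W) (hb) (p : P.bimod) (v : V) :
    P.tensorDescK b hb (P.tmk V p v) = b p v := rfl

/-- The morphism `P ⊗_R V ⟶ W` induced by a balanced bilinear map that is `S`-linear in its first
variable. -/
def tensorDesc {V : FDMod k R} {W : FDMod k S} (b : P.bimod →ₗ[k] V →ₗ[k] W)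
    (hb : ∀ (p : P.bimod) (r : R) (v : V), b (op r • p) v = b p (r • v))
    (hs : ∀ (s : S) (p : P.bimod) (v : V), b (s • p) v = s • b p v) :
    P.tensorObj V ⟶ W :=
  FDMod.ofLin
    { toFun := P.tensorDescK b hb
      map_add' := map_add (P.tensorDescK b hb)
      map_smul' := fun s x => by
        refine P.tensorObj_induction (motive := fun x : P.tensorObj V =>
          P.tensorDescK b hb (s • x) = s • P.tensorDescK b hb x) (by simp) (fun p v => ?_)
          (fun x y hx hy => ?_) x
        · rw [smul_tmk, tensorDescK_tmk, tensorDescK_tmk, hs]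
        · rw [smul_add, map_add, map_add, smul_add, hx, hy] }

end EquivBimod

/-! ### The module functor of a Morita context is an equivalence -/

section Contraction

variable {k H S R : Type u} [Field k] [Ring H] [Ring S] [Ring R] [Bialgebra k H]
  [Algebra k S] [Algebra k R] [LeftComoduleAlgebra k H S] [LeftComoduleAlgebra k H R]

/-- The part of an equivariant Morita context on `P` and `Q` that makes `Q ⊗_S (P ⊗_R V)`
isomorphic to `V`: pairings `f` and `g` such that `g` is a balanced, colinear morphism of bimodules
whose values generate the unit of `R`, and such that `f` and `g` are associative. -/
structure Contraction (P : EquivBimod k H S R) (Q : EquivBimod k H R S) where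
  f : P.bimod →ₗ[k] Q.bimod →ₗ[k] S
  g : Q.bimod →ₗ[k] P.bimod →ₗ[k] R
  smul_left : ∀ (r : R) (q : Q.bimod) (p : P.bimod), g (r • q) p = r * g q p
  op_smul_left : ∀ (s : S) (q : Q.bimod) (p : P.bimod), g (op s • q) p = g q (s • p)
  op_smul_right : ∀ (r : R) (q : Q.bimod) (p : P.bimod), g q (op r • p) = g q p * r
  f_smul : ∀ (p : P.bimod) (q : Q.bimod) (p' : P.bimod), f p q • p' = op (g q p') • p
  g_smul : ∀ (q : Q.bimod) (p : P.bimod) (q' : Q.bimod), g q p • q' = op (f p q') • q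
  coact_g : ∀ (q : Q.bimod) (p : P.bimod), coact k H R (g q p) =
    tensorBilin (LinearMap.mul k H) g (Q.coaction q) (P.coaction p)
  exists_sum_eq_one : ∃ (n : ℕ) (q : Fin n → Q.bimod) (p : Fin n → P.bimod),
    ∑ i, g (q i) (p i) = 1

namespace Contraction

variable {P : EquivBimod k H S R} {Q : EquivBimod k H R S} (c : Contraction P Q)

/-- The bilinear map `(q, p ⊗ v) ↦ g (q ⊗ p) • v`. -/
def bilin (V : FDMod k R) : Q.bimod →ₗ[k] P.tensorObj V →ₗ[k] V :=
  (P.tensorDescK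
    (LinearMap.mk₂ k (fun p v => (Algebra.lsmul k k V).toLinearMap.flip v ∘ₗ c.g.flip p)
      (fun p p' v => by ext q; simp) (fun c p v => by ext q; simp)
      (fun p v v' => by ext q; simp) (fun c p v => by ext q; simp))
    (fun p r v => by
      ext q
      simp only [LinearMap.mk₂_apply, LinearMap.comp_apply, LinearMap.flip_apply, c.op_smul_right]
      exact mul_smul _ _ v)).flip

@[simp]
theorem bilin_tmk (V : FDMod k R) (q : Q.bimod) (p : P.bimod) (v : V) :
    c.bilin V q (P.tmk V p v) = c.g q p • v := rfl

/-- The morphism `Q ⊗_S (P ⊗_R V) ⟶ V`, `q ⊗ p ⊗ v ↦ g (q ⊗ p) • v`. -/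
def hom (V : FDMod k R) : Q.tensorObj (P.tensorObj V) ⟶ V :=
  Q.tensorDesc (c.bilin V)
    (fun q s x => by
      refine P.tensorObj_induction (motive := fun x => c.bilin V (op s • q) x =
        c.bilin V q (s • x)) (by simp) (fun p v => ?_) (fun x y hx hy => ?_) x
      · rw [EquivBimod.smul_tmk, bilin_tmk, bilin_tmk, c.op_smul_left]
      · rw [smul_add, map_add, map_add, hx, hy])
    (fun r q x => by
      refine P.tensorObj_induction (motive := fun x => c.bilin V (r • q) x =
        r • c.bilin V q x) (by simp) (fun p v => ?_) (fun x y hx hy => ?_) x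
      · rw [bilin_tmk, bilin_tmk, ← mul_smul, c.smul_left]
      · rw [map_add, map_add, smul_add, hx, hy])

@[simp]
theorem lin_hom (V : FDMod k R) (q : Q.bimod) (p : P.bimod) (v : V) :
    FDMod.lin (c.hom V) (Q.tmk _ q (P.tmk V p v)) = c.g q p • v := rfl

theorem tensorObj_tensorObj_induction {V : FDMod k R}
    {motive : Q.tensorObj (P.tensorObj V) → Prop} (zero : motive 0)
    (mk : ∀ q p v, motive (Q.tmk _ q (P.tmk V p v)))
    (add : ∀ x y, motive x → motive y → motive (x + y)) (x) : motive x := by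
  refine Q.tensorObj_induction zero (fun q x => ?_) add x
  refine P.tensorObj_induction (motive := fun x => motive (Q.tmk _ q x)) ?_
    (fun p v => mk q p v) (fun x y hx hy => ?_) x
  · rw [map_zero]; exact zero
  · rw [map_add]; exact add _ _ hx hy

theorem hom_bijective (V : FDMod k R) : Function.Bijective (FDMod.lin (c.hom V)) := by
  obtain ⟨n, x, y, hxy⟩ := c.exists_sum_eq_one
  -- The inverse is `v ↦ ∑ xᵢ ⊗ yᵢ ⊗ v`.
  let T : V →ₗ[k] Q.tensorObj (P.tensorObj V) := ∑ i, Q.tmk _ (x i) ∘ₗ P.tmk V (y i)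
  have hT : ∀ v, T v = ∑ i, Q.tmk _ (x i) (P.tmk V (y i) v) := fun v => by simp [T]
  refine Function.bijective_iff_has_inverse.2 ⟨T, fun z => ?_, fun v => ?_⟩
  · refine tensorObj_tensorObj_induction (motive := fun z => T (FDMod.lin (c.hom V) z) = z)
      (by simp) (fun q p v => ?_) (fun z z' hz hz' => by rw [map_add, map_add, hz, hz']) z
    have h1 : ∀ i, Q.tmk _ (x i) (P.tmk V (y i) (c.g q p • v)) =
        Q.tmk _ (c.g (x i) (y i) • q) (P.tmk V p v) := fun i => by
      rw [← P.tmk_smul, ← c.f_smul, ← P.smul_tmk, ← Q.tmk_smul, ← c.g_smul]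
    rw [lin_hom, hT]
    simp only [h1]
    rw [← LinearMap.sum_apply, ← map_sum, ← Finset.sum_smul, hxy, one_smul]
  · rw [hT, map_sum]
    simp only [lin_hom, ← Finset.sum_smul, hxy, one_smul]

theorem hom_comm (X : FDMod k H) (V : FDMod k R) :
    c.hom (actObj X V) = (Q.tensorMap (P.lineator X V) ≫ Q.lineator X (P.tensorObj V)) ≫
      actMap (𝟙 X) (c.hom V) := by
  refine FDMod.hom_ext fun z => tensorObj_tensorObj_induction
    (motive := fun z => FDMod.lin (c.hom (actObj X V)) z = FDMod.lin _ z)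
    (by simp) (fun q p w => ?_) (fun z z' hz hz' => by rw [map_add, map_add, hz, hz']) z
  obtain ⟨t, rfl⟩ := (actEquiv X V).surjective w
  rw [lin_hom, smul_actEquiv, c.coact_g]
  simp only [FDMod.lin_comp, LinearMap.comp_apply, EquivBimod.lin_tensorMap_tmk,
    EquivBimod.lin_lineator_tmk]
  generalize Q.coaction q = y
  generalize P.coaction p = z
  induction y with
  | zero => simp
  | add a b ha hb => simp only [map_add, LinearMap.add_apply, ha, hb]
  | tmul h q =>
    induction z with
    | zero => simp
    | add a b ha hb => simp only [map_add, LinearMap.add_apply, ha, hb]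
    | tmul h' p =>
      induction t with
      | zero => simp
      | add a b ha hb => simp only [map_add, ha, hb]
      | tmul x v => simp [EquivBimod.preLineator, mul_smul]

/-- The isomorphism `V ≅ Q ⊗_S (P ⊗_R V)` of module functors. -/
def idIso : OplaxModuleFunctor.id k (FDMod k H) (FDMod k R) ≅
    P.moduleFunctor.comp Q.moduleFunctor :=
  let α : P.moduleFunctor.comp Q.moduleFunctor ⟶
      OplaxModuleFunctor.id k (FDMod k H) (FDMod k R) :=
    { natTrans :=
        { app := fun V => c.hom V
          naturality := fun V W f => FDMod.hom_ext fun z => tensorObj_tensorObj_induction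
            (motive := fun z => FDMod.lin (Q.tensorMap (P.tensorMap f) ≫ c.hom W) z =
              FDMod.lin (c.hom V ≫ f) z) (by simp) (fun q p v => by simp)
            (fun z z' hz hz' => by rw [map_add, map_add, hz, hz']) z }
      comm := fun X V => (Category.comp_id _).trans (c.hom_comm X V) }
  haveI : ∀ V, IsIso (α.natTrans.app V) :=
    fun V => FDMod.isIso_of_bijective _ (c.hom_bijective V)
  (OplaxModuleFunctor.isoOfComponents α).symm

end Contraction

namespace EquivMoritaContext

variable {M : EquivMoritaContext k H R S} {ρ : M.Q →ₗ[k] H ⊗[k] M.Q}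

/-- The Morita context `(Q, P, g, f)`, equivariant for a dual coaction on `Q`. -/
def dual (hρ : M.IsDualCoaction ρ) : EquivMoritaContext k H S R where
  toMoritaContext := M.symm
  coaction := ρ
  isEquivariant := hρ.isEquivariant

theorem isDualCoaction_dual (hρ : M.IsDualCoaction ρ) : (dual hρ).IsDualCoaction M.coaction where
  isEquivariant := M.isEquivariant
  f_coact := hρ.g_coact
  g_coact := hρ.f_coact

/-- The contraction of `P` with `Q` given by the pairings of a Morita context. -/
def contraction (hρ : M.IsDualCoaction ρ) : Contraction M.equivBimod (dual hρ).equivBimod where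
  f := M.fBilin
  g := M.gBilin
  smul_left := M.gBilin_smul_left
  op_smul_left := M.gBilin_op_smul_left
  op_smul_right := M.gBilin_op_smul_right
  f_smul := M.fBilin_smul
  g_smul := M.gBilin_smul
  coact_g := hρ.g_coact
  exists_sum_eq_one := M.exists_sum_gBilin_eq_one

theorem isModuleEquivalence_of_isDualCoaction (hρ : M.IsDualCoaction ρ) :
    M.moduleFunctor.IsModuleEquivalence :=
  OplaxModuleFunctor.isModuleEquivalence_of_iso (contraction hρ).idIso
    (contraction (isDualCoaction_dual hρ)).idIso

theorem isModuleEquivalence {k H R S : Type u} [Field k] [Ring H] [Ring R] [Ring S]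
    [HopfAlgebra k H] [Algebra k R] [Algebra k S] [LeftComoduleAlgebra k H R]
    [LeftComoduleAlgebra k H S] (M : EquivMoritaContext k H R S) :
    M.moduleFunctor.IsModuleEquivalence :=
  let ⟨_, hρ, _⟩ := M.existsUnique_isDualCoaction
  isModuleEquivalence_of_isDualCoaction hρ

end EquivMoritaContext

end Contraction

/-! ### The regular module -/

theorem FDMod.lin_sum {k A : Type u} [Field k] [Ring A] [Algebra k A] {V W : FDMod k A}
    {ι : Type*} (s : Finset ι) (f : ι → (V ⟶ W)) :
    FDMod.lin (∑ i ∈ s, f i) = ∑ i ∈ s, FDMod.lin (f i) :=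
  map_sum (AddMonoidHom.mk' (FDMod.lin (M := V) (N := W)) FDMod.lin_add) f s

section Regular

variable {k A : Type u} [Field k] [Ring A] [Algebra k A] [FiniteDimensional k A]

variable (k A) in
/-- The algebra `A` as a left module over itself. -/
def regObj : FDMod k A where
  carrier := A

variable (k A) in
/-- The identification of the underlying space of `regObj` with `A`. -/
def regEquiv : A ≃ₗ[k] regObj k A := LinearEquiv.refl k A

theorem smul_regEquiv (a b : A) : a • regEquiv k A b = regEquiv k A (a * b) := rfl

/-- The morphism `A ⟶ V` that sends `1` to `v`. -/
def eltHom {V : FDMod k A} (v : V) : regObj k A ⟶ V :=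
  FDMod.ofLin (LinearMap.toSpanSingleton A V v : A →ₗ[A] V)

@[simp]
theorem lin_eltHom {V : FDMod k A} (v : V) (a : A) :
    FDMod.lin (eltHom v) (regEquiv k A a) = a • v := rfl

theorem reg_ext {V : FDMod k A} {f g : regObj k A ⟶ V}
    (h : FDMod.lin f (regEquiv k A 1) = FDMod.lin g (regEquiv k A 1)) : f = g :=
  FDMod.hom_ext fun m => by
    obtain ⟨a, rfl⟩ := (regEquiv k A).surjective m
    rw [← mul_one a, ← smul_regEquiv, map_smul, map_smul, h]

theorem eltHom_comp {V W : FDMod k A} (v : V) (f : V ⟶ W) :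
    eltHom v ≫ f = eltHom (FDMod.lin f v) := reg_ext (by simp)

theorem eltHom_lin {V : FDMod k A} (f : regObj k A ⟶ V) :
    eltHom (FDMod.lin f (regEquiv k A 1)) = f := reg_ext (by simp)

theorem eltHom_add {V : FDMod k A} (v w : V) : eltHom (v + w) = eltHom v + eltHom w :=
  reg_ext (by simp)

theorem eltHom_smul {V : FDMod k A} (c : k) (v : V) : eltHom (c • v) = c • eltHom v :=
  reg_ext (by simp)

theorem eltHom_zero {V : FDMod k A} : eltHom (0 : V) = 0 :=
  reg_ext (by simp; rfl)

theorem eltHom_sum {V : FDMod k A} {ι : Type*} (s : Finset ι) (v : ι → V) :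
    eltHom (∑ i ∈ s, v i) = ∑ i ∈ s, eltHom (v i) :=
  map_sum (AddMonoidHom.mk' (eltHom (V := V)) eltHom_add) v s

theorem eltHom_injective {V : FDMod k A} {v w : V} (h : eltHom v = eltHom w) : v = w := by
  simpa using congrArg (fun f => FDMod.lin f (regEquiv k A 1)) h

end Regular

/-! ### Isomorphic contexts and isomorphic functors -/

namespace EquivBimod

variable {k H S R : Type u} [Field k] [Ring H] [Ring S] [Ring R] [Bialgebra k H]
  [Algebra k S] [Algebra k R] [LeftComoduleAlgebra k H S] [LeftComoduleAlgebra k H R]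

/-- `u` is an isomorphism of equivariant bimodules. -/
structure IsBimodIso {P P' : EquivBimod k H S R} (u : P.bimod ≃ₗ[k] P'.bimod) : Prop where
  map_smul : ∀ (s : S) (p : P.bimod), u (s • p) = s • u p
  map_op_smul : ∀ (r : R) (p : P.bimod), u (op r • p) = op r • u p
  coaction : ∀ p : P.bimod, P'.coaction (u p) = u.toLinearMap.lTensor H (P.coaction p)

variable {P P' : EquivBimod k H S R}

/-- The isomorphism `P ⊗_R - ≅ P' ⊗_R -` of module functors induced by `u : P ≃ P'`. -/
def moduleFunctorIso {u : P.bimod ≃ₗ[k] P'.bimod} (hu : IsBimodIso u) :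
    P.moduleFunctor ≅ P'.moduleFunctor :=
  let φ (V : FDMod k R) : P.tensorObj V ⟶ P'.tensorObj V :=
    P.tensorDesc (P'.tmk V ∘ₗ u.toLinearMap)
      (fun p r v => by simp [hu.map_op_smul, tmk_smul])
      (fun s p v => by simp [hu.map_smul, smul_tmk])
  have hφ : ∀ V p v, FDMod.lin (φ V) (P.tmk V p v) = P'.tmk V (u p) v := fun _ _ _ => rfl
  let α : P.moduleFunctor ⟶ P'.moduleFunctor :=
    { natTrans :=
        { app := φ
          naturality := fun V W f => P.tensorObj_ext fun p v => rfl }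
      comm := fun X V => P.tensorObj_ext fun p w => by
        obtain ⟨t, rfl⟩ := (actEquiv X V).surjective w
        change actEquiv X (P'.tensorObj V) (P'.preLineator X V (P'.coaction (u p)) t) =
          FDMod.lin (actMap (𝟙 X) (φ V)) (actEquiv X (P.tensorObj V)
            (P.preLineator X V (P.coaction p) t))
        rw [hu.coaction]
        induction P.coaction p with
        | zero => simp
        | add a b ha hb => simp only [map_add, LinearMap.add_apply, ha, hb]
        | tmul h p =>
          induction t with
          | zero => simp
          | add a b ha hb => simp only [map_add, ha, hb]
          | tmul x v => simp [preLineator, hφ] }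
  haveI : ∀ V, IsIso (α.natTrans.app V) := fun V => by
    let ψ : P'.tensorObj V →ₗ[k] P.tensorObj V :=
      P'.tensorDescK (P.tmk V ∘ₗ u.symm.toLinearMap) fun p r v => by
        obtain ⟨p, rfl⟩ := u.surjective p
        simp [← hu.map_op_smul, tmk_smul]
    refine FDMod.isIso_of_bijective (φ V) (Function.bijective_iff_has_inverse.2
      ⟨ψ, fun z => ?_, fun z => ?_⟩)
    · exact P.tensorObj_induction (motive := fun z => ψ (FDMod.lin (φ V) z) = z) (by simp)
        (fun p v => by simp [ψ, hφ]) (fun x y hx hy => by rw [map_add, map_add, hx, hy]) z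
    · exact P'.tensorObj_induction (motive := fun z => FDMod.lin (φ V) (ψ z) = z) (by simp)
        (fun p v => by simp [ψ, hφ]) (fun x y hx hy => by rw [map_add, map_add, hx, hy]) z
  OplaxModuleFunctor.isoOfComponents α

variable [FiniteDimensional k R]

variable (P) in
/-- The isomorphism `P ≃ P ⊗_R R`, `p ↦ p ⊗ 1`. -/
def tensorReg : P.bimod ≃ₗ[k] P.tensorObj (regObj k R) :=
  LinearEquiv.ofLinearMap ((P.tmk _).flip (regEquiv k R 1))
    (P.tensorDescK (P.bimod.rightAct.compl₂ (regEquiv k R).symm.toLinearMap) fun p r v => by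
      obtain ⟨v, rfl⟩ := (regEquiv k R).surjective v
      simp [smul_regEquiv, mul_smul])
    (LinearMap.ext fun z => P.tensorObj_induction (motive := fun z => _ = LinearMap.id z) (by simp)
        (fun p v => by
          obtain ⟨v, rfl⟩ := (regEquiv k R).surjective v
          simp [tmk_smul, smul_regEquiv])
        (fun x y hx hy => by rw [map_add, map_add, hx, hy]) z)
    (by ext p; simp)

theorem tensorReg_apply (p : P.bimod) : P.tensorReg p = P.tmk _ p (regEquiv k R 1) := rfl

theorem tensorReg_smul (s : S) (p : P.bimod) : P.tensorReg (s • p) = s • P.tensorReg p := rfl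

theorem tensorReg_op_smul (r : R) (p : P.bimod) :
    P.tensorReg (op r • p) = FDMod.lin (P.tensorMap (eltHom (regEquiv k R r))) (P.tensorReg p) := by
  simp [tensorReg_apply, tmk_smul, smul_regEquiv]

variable [FiniteDimensional k H]

theorem lin_lineator_tensorReg (p : P.bimod) :
    FDMod.lin (P.tensorMap (eltHom (actEquiv (regObj k H) (regObj k R)
        (regEquiv k H 1 ⊗ₜ regEquiv k R 1))) ≫ P.lineator (regObj k H) (regObj k R))
      (P.tensorReg p) =
    actEquiv (regObj k H) (P.tensorObj (regObj k R))
      (TensorProduct.congr (regEquiv k H) P.tensorReg (P.coaction p)) := by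
  simp only [FDMod.lin_comp, LinearMap.comp_apply, tensorReg_apply, lin_tensorMap_tmk, lin_eltHom,
    one_smul, lin_lineator_tmk]
  congr 1
  induction P.coaction p with
  | zero => simp
  | add a b ha hb => simp only [map_add, LinearMap.add_apply, ha, hb]
  | tmul h p => simp [preLineator, smul_regEquiv, tensorReg_apply]

/-- An isomorphism `P ⊗_R - ≅ P' ⊗_R -` of module functors comes from an isomorphism `P ≃ P'`,
namely its component at the regular module `R`. -/
theorem exists_isBimodIso (α : P.moduleFunctor ≅ P'.moduleFunctor) :
    ∃ u : P.bimod ≃ₗ[k] P'.bimod, IsBimodIso u := by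
  let a (V : FDMod k R) : P.tensorObj V ⟶ P'.tensorObj V := α.hom.natTrans.app V
  let b : P'.tensorObj (regObj k R) ⟶ P.tensorObj (regObj k R) := α.inv.natTrans.app (regObj k R)
  have hab : a (regObj k R) ≫ b = 𝟙 _ := NatTrans.congr_app
    (congrArg OplaxModuleFunctor.Hom.natTrans α.hom_inv_id) (regObj k R)
  have hba : b ≫ a (regObj k R) = 𝟙 _ := NatTrans.congr_app
    (congrArg OplaxModuleFunctor.Hom.natTrans α.inv_hom_id) (regObj k R)
  have nat : ∀ {V W : FDMod k R} (f : V ⟶ W), P.tensorMap f ≫ a W = a V ≫ P'.tensorMap f :=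
    fun f => α.hom.natTrans.naturality f
  have comm : a (actObj (regObj k H) (regObj k R)) ≫ P'.lineator _ _ =
      P.lineator _ _ ≫ actMap (𝟙 _) (a _) := α.hom.comm (regObj k H) (regObj k R)
  let e : P.tensorObj (regObj k R) ≃ₗ[k] P'.tensorObj (regObj k R) :=
    LinearEquiv.ofLinearMap (FDMod.klin (a _)) (FDMod.klin b)
      (LinearMap.ext fun z => congrArg (fun f => FDMod.lin f z) hba)
      (LinearMap.ext fun z => congrArg (fun f => FDMod.lin f z) hab)
  let u : P.bimod ≃ₗ[k] P'.bimod := (P.tensorReg.trans e).trans P'.tensorReg.symm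
  have hu : ∀ p, P'.tensorReg (u p) = FDMod.lin (a (regObj k R)) (P.tensorReg p) :=
    fun p => P'.tensorReg.apply_symm_apply _
  refine ⟨u, fun s p => ?_, fun r p => ?_, fun p => ?_⟩
  · apply P'.tensorReg.injective
    rw [tensorReg_smul, hu, hu, tensorReg_smul, map_smul]
  · apply P'.tensorReg.injective
    rw [tensorReg_op_smul, hu, hu, tensorReg_op_smul, ← LinearMap.comp_apply, ← FDMod.lin_comp, nat,
      FDMod.lin_comp, LinearMap.comp_apply]
  · apply (TensorProduct.congr (regEquiv k H) P'.tensorReg).injective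
    apply (actEquiv (regObj k H) (P'.tensorObj (regObj k R))).injective
    rw [← lin_lineator_tensorReg, hu, ← LinearMap.comp_apply, ← FDMod.lin_comp, ← Category.assoc,
      ← nat, Category.assoc, comm, ← Category.assoc, FDMod.lin_comp, LinearMap.comp_apply,
      lin_lineator_tensorReg]
    induction P.coaction p with
    | zero => simp
    | add a b ha hb => simp only [map_add, ha, hb]
    | tmul h p => simp [hu]

end EquivBimod

namespace MoritaContext

variable {k R S : Type u} [Field k] [Ring R] [Ring S] [Algebra k R] [Algebra k S]
  {M M' : MoritaContext k R S}

theorem eq_of_fBilin_eq {q q' : M.Q} (h : ∀ p, M.fBilin p q = M.fBilin p q') : q = q' :=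
  sub_eq_zero.1 <| M.eq_zero_of_fBilin_eq_zero fun p => by rw [map_sub, h, sub_self]

theorem exists_linearMap_of_equiv (u : M.P ≃ₗ[k] M'.P)
    (hu : ∀ (s : S) (p : M.P), u (s • p) = s • u p) :
    ∃ v : M.Q →ₗ[k] M'.Q, ∀ p q, M'.fBilin (u p) (v q) = M.fBilin p q := by
  obtain ⟨n, x, y, hxy⟩ := M'.exists_sum_gBilin_eq_one
  refine ⟨∑ i, M'.Q.rightAct (x i) ∘ₗ M.fBilin (u.symm (y i)), fun p q => ?_⟩
  have h1 : ∀ i, M'.fBilin (u p) (x i) * M.fBilin (u.symm (y i)) q =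
      M.fBilin (u.symm (M'.fBilin (u p) (x i) • y i)) q := fun i => by
    rw [← M.fBilin_smul_left]
    congr 2
    exact u.injective (by simp [hu])
  simp only [LinearMap.sum_apply, LinearMap.comp_apply, map_sum, FDBimod.rightAct_apply,
    M'.fBilin_op_smul_right, h1]
  rw [← LinearMap.sum_apply, ← map_sum, ← map_sum]
  simp only [M'.fBilin_smul, ← Finset.sum_smul, ← Finset.op_sum, hxy, op_one, one_smul,
    u.symm_apply_apply]

/-- An isomorphism `P ≃ P'` extends to an isomorphism of Morita contexts, since `Q` is dual
to `P`. -/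
theorem exists_equiv_of_equiv (u : M.P ≃ₗ[k] M'.P)
    (hs : ∀ (s : S) (p : M.P), u (s • p) = s • u p)
    (hr : ∀ (r : R) (p : M.P), u (op r • p) = op r • u p) :
    ∃ v : M.Q ≃ₗ[k] M'.Q,
      (∀ (r : R) (q : M.Q), v (r • q) = r • v q) ∧
      (∀ (s : S) (q : M.Q), v (op s • q) = op s • v q) ∧
      (∀ (p : M.P) (q : M.Q), M'.fBilin (u p) (v q) = M.fBilin p q) ∧
      (∀ (q : M.Q) (p : M.P), M'.gBilin (v q) (u p) = M.gBilin q p) := by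
  obtain ⟨v, hv⟩ := exists_linearMap_of_equiv u hs
  obtain ⟨w, hw⟩ := exists_linearMap_of_equiv u.symm fun s p => u.injective (by simp [hs])
  have hv' : ∀ p q, M'.fBilin p (v q) = M.fBilin (u.symm p) q := fun p q => by
    rw [← hv, u.apply_symm_apply]
  have hw' : ∀ p q, M.fBilin p (w q) = M'.fBilin (u p) q := fun p q => by
    rw [← hw, u.symm_apply_apply]
  have hr' : ∀ (r : R) (p : M'.P), u.symm (op r • p) = op r • u.symm p :=
    fun r p => u.injective (by simp [hr])
  refine ⟨LinearEquiv.ofLinearMap v w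
    (LinearMap.ext fun q => M'.eq_of_fBilin_eq fun p => by simp [hv', hw'])
    (LinearMap.ext fun q => M.eq_of_fBilin_eq fun p => by simp [hv', hw']),
    fun r q => M'.eq_of_fBilin_eq fun p => ?_, fun s q => M'.eq_of_fBilin_eq fun p => ?_,
    hv, fun q p => ?_⟩
  · simp [hv', ← M.fBilin_op_smul_left, ← M'.fBilin_op_smul_left, hr']
  · simp [hv', M.fBilin_op_smul_right, M'.fBilin_op_smul_right]
  · rw [← sub_eq_zero]
    refine M'.eq_zero_of_op_smul_eq_zero fun p' => ?_
    obtain ⟨p', rfl⟩ := u.surjective p'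
    rw [MulOpposite.op_sub, sub_smul, sub_eq_zero, ← M'.fBilin_smul, ← hr, ← M.fBilin_smul, hs]
    exact congrArg (· • u p) (hv p' q)

end MoritaContext

namespace EquivMoritaContext

variable {k H R S : Type u} [Field k] [Ring H] [Ring R] [Ring S] [Bialgebra k H]
  [Algebra k R] [Algebra k S] [LeftComoduleAlgebra k H R] [LeftComoduleAlgebra k H S]
  [FiniteDimensional k R] [FiniteDimensional k H]

theorem isIsomorphic_iff (M M' : EquivMoritaContext k H R S) :
    M.IsIsomorphic M' ↔ Nonempty (M.moduleFunctor ≅ M'.moduleFunctor) := by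
  constructor
  · rintro ⟨u, _, h1, h2, h3, _⟩
    exact ⟨EquivBimod.moduleFunctorIso (P := M.equivBimod) (P' := M'.equivBimod) (u := u)
      ⟨h1, h2, h3⟩⟩
  · rintro ⟨α⟩
    obtain ⟨u, hu⟩ := EquivBimod.exists_isBimodIso (P := M.equivBimod) (P' := M'.equivBimod) α
    obtain ⟨v, hv⟩ := MoritaContext.exists_equiv_of_equiv (M := M.toMoritaContext)
      (M' := M'.toMoritaContext) u hu.map_smul hu.map_op_smul
    exact ⟨u, v, hu.map_smul, hu.map_op_smul, hu.coaction, hv⟩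

end EquivMoritaContext

/-! ### Morita contexts from progenerators -/

namespace FDBimod

variable {k R S : Type u} [Field k] [Ring R] [Ring S] [Algebra k R] [Algebra k S]

/-- Associative pairings `f : P × Q → S` and `g : Q × P → R` such that `1` lies in the image of `f`
induce a bijection `P ⊗_R Q ≃ S`. -/
theorem exists_balEquiv {P : FDBimod k S R} {Q : FDBimod k R S} (f : P →ₗ[k] Q →ₗ[k] S)
    (g : Q →ₗ[k] P →ₗ[k] R)
    (smul_left : ∀ (s : S) (p : P) (q : Q), f (s • p) q = s * f p q)
    (op_smul_left : ∀ (r : R) (p : P) (q : Q), f (op r • p) q = f p (r • q))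
    (f_smul : ∀ (p : P) (q : Q) (p' : P), f p q • p' = op (g q p') • p)
    (g_smul : ∀ (q : Q) (p : P) (q' : Q), g q p • q' = op (f p q') • q)
    (one : ∃ (n : ℕ) (p : Fin n → P) (q : Fin n → Q), ∑ i, f (p i) (q i) = 1) :
    ∃ e : P.BalTensor Q ≃ₗ[S] S, ∀ p q, e (P.balMk Q p q) = f p q := by
  obtain ⟨n, x, y, hxy⟩ := one
  let φ : P.BalTensor Q →ₗ[k] S := balDesc f fun p r q => op_smul_left r p q
  have hφ : ∀ p q, φ (P.balMk Q p q) = f p q := fun p q => rfl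
  have ind : ∀ {motive : P.BalTensor Q → Prop}, motive 0 → (∀ p q, motive (P.balMk Q p q)) →
      (∀ a b, motive a → motive b → motive (a + b)) → ∀ t, motive t := by
    intro motive h0 h1 h2 t
    obtain ⟨t, rfl⟩ := (P.balRel Q).mkQ_surjective t
    induction t with
    | zero => exact h0
    | tmul p v => exact h1 p v
    | add s t hs ht => rw [map_add]; exact h2 _ _ hs ht
  have hs : ∀ (s : S) t, φ (s • t) = s • φ t := fun s t => by
    refine ind (motive := fun t => φ (s • t) = s • φ t) (by simp) (fun p q => ?_)
      (fun a b ha hb => by rw [smul_add, map_add, map_add, smul_add, ha, hb]) t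
    rw [smul_balMk, hφ, hφ, smul_left, smul_eq_mul]
  have hz : ∀ t, φ t • ∑ i, P.balMk Q (x i) (y i) = t := fun t => by
    refine ind (motive := fun t => φ t • ∑ i, P.balMk Q (x i) (y i) = t) (by simp) (fun p q => ?_)
      (fun a b ha hb => by rw [map_add, add_smul, ha, hb]) t
    rw [hφ, Finset.smul_sum]
    simp only [smul_balMk, f_smul, balMk_smul, g_smul]
    rw [← map_sum, ← Finset.sum_smul, ← Finset.op_sum, hxy, op_one, one_smul]
  refine ⟨LinearEquiv.ofBijective { toFun := φ, map_add' := map_add φ, map_smul' := hs }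
    (Function.bijective_iff_has_inverse.2
      ⟨fun s => s • ∑ i, P.balMk Q (x i) (y i), hz, fun s => ?_⟩), hφ⟩
  change φ (s • ∑ i, P.balMk Q (x i) (y i)) = s
  rw [hs, map_sum]
  simp only [hφ, hxy, smul_eq_mul, mul_one]

/-- `P` is a progenerator as a left `S`-module, and the right action identifies `R` with the
opposite of its endomorphism algebra. -/
structure IsProgenerator (P : FDBimod k S R) : Prop where
  exists_eq_op_smul : ∀ e : P →ₗ[S] P, ∃ r : R, ∀ p, op r • p = e p
  eq_zero : ∀ r : R, (∀ p : P, op r • p = 0) → r = 0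
  generator : ∃ (n : ℕ) (p : Fin n → P) (φ : Fin n → P →ₗ[S] S), ∑ i, φ i (p i) = 1
  dual_basis : ∃ (n : ℕ) (φ : Fin n → P →ₗ[S] S) (x : Fin n → P), ∀ p, ∑ i, φ i p • x i = p

section Dual

variable (P : FDBimod k S R)

/-- The left action of `R` on `Hom_S(P, S)`, `(r • φ) p = φ (p * r)`. -/
abbrev dualModule : Module R (P →ₗ[S] S) where
  smul r φ := φ ∘ₗ { toFun := fun p => op r • p
                     map_add' := smul_add _
                     map_smul' := fun s p => (smul_comm s (op r) p).symm }
  one_smul φ := LinearMap.ext fun p => congrArg φ (one_smul Rᵐᵒᵖ p)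
  mul_smul r r' φ := LinearMap.ext fun p => congrArg φ (mul_smul (op r') (op r) p)
  smul_zero _ := rfl
  smul_add _ _ _ := rfl
  add_smul r r' φ := LinearMap.ext fun p =>
    (congrArg φ (add_smul (op r) (op r') p)).trans (map_add φ _ _)
  zero_smul φ := LinearMap.ext fun p => (congrArg φ (zero_smul Rᵐᵒᵖ p)).trans (map_zero φ)

/-- The dual `Hom_S(P, S)` with the actions `(r • φ * s) p = φ (p * r) * s`. -/
def dual [FiniteDimensional k S] : FDBimod k R S :=
  letI := P.dualModule
  { carrier := P →ₗ[S] S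
    leftTower := ⟨fun c r φ => LinearMap.ext fun p => by
      change φ (op (c • r) • p) = c • φ (op r • p)
      rw [op_smul, smul_assoc, LinearMap.map_smul_of_tower]⟩
    smulComm := ⟨fun r s φ => rfl⟩
    finite := Module.Finite.of_injective (LinearMap.restrictScalarsₗ k S P S k)
      (LinearMap.restrictScalars_injective k) }

variable [FiniteDimensional k S]

/-- The elements of the dual as linear functionals. -/
def dualEquiv : P.dual ≃ₗ[k] (P →ₗ[S] S) := LinearEquiv.refl k _

@[simp]
theorem dualEquiv_smul (r : R) (φ : P.dual) (p : P) :
    P.dualEquiv (r • φ) p = P.dualEquiv φ (op r • p) := rfl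

@[simp]
theorem dualEquiv_op_smul (s : S) (φ : P.dual) (p : P) :
    P.dualEquiv (op s • φ) p = P.dualEquiv φ p * s := rfl

/-- The evaluation pairing `P × Hom_S(P, S) → S`. -/
def evalBilin : P →ₗ[k] P.dual →ₗ[k] S :=
  LinearMap.mk₂ k (fun p φ => P.dualEquiv φ p) (fun p p' φ => map_add _ p p')
    (fun c p φ => LinearMap.map_smul_of_tower _ c p) (fun p φ φ' => by simp)
    (fun c p φ => by simp)

@[simp]
theorem evalBilin_apply (p : P) (φ : P.dual) : P.evalBilin p φ = P.dualEquiv φ p := rfl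

end Dual

namespace IsProgenerator

variable {P : FDBimod k S R}

theorem eq_of_op_smul_eq (hP : P.IsProgenerator) {r r' : R} (h : ∀ p : P, op r • p = op r' • p) :
    r = r' :=
  sub_eq_zero.1 <| hP.eq_zero _ fun p => by rw [MulOpposite.op_sub, sub_smul, h, sub_self]

variable [FiniteDimensional k S]

/-- The pairing `g : Hom_S(P, S) × P → R`, for which right multiplication by `g (φ, p)` is the
endomorphism `p' ↦ φ p' • p`. -/
theorem exists_pairing (hP : P.IsProgenerator) : ∃ g : P.dual →ₗ[k] P →ₗ[k] R,
    ∀ (φ : P.dual) (p p' : P), op (g φ p) • p' = P.dualEquiv φ p' • p := by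
  choose g hg using fun (φ : P.dual) (p : P) => hP.exists_eq_op_smul
    (LinearMap.toSpanSingleton S P p ∘ₗ P.dualEquiv φ)
  replace hg : ∀ (φ : P.dual) (p p' : P), op (g φ p) • p' = P.dualEquiv φ p' • p := hg
  refine ⟨LinearMap.mk₂ k g (fun φ φ' p => hP.eq_of_op_smul_eq fun p' => ?_)
    (fun c φ p => hP.eq_of_op_smul_eq fun p' => ?_)
    (fun φ p q => hP.eq_of_op_smul_eq fun p' => ?_)
    (fun c φ p => hP.eq_of_op_smul_eq fun p' => ?_), hg⟩
  · simp only [MulOpposite.op_add, add_smul, hg, map_add, LinearMap.add_apply]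
  · simp only [op_smul, smul_assoc, hg, map_smul, LinearMap.smul_apply]
  · simp only [MulOpposite.op_add, add_smul, hg, smul_add]
  · simp only [op_smul, smul_assoc, hg, smul_comm c]

/-- A progenerator `P` and its dual `Hom_S(P, S)` form a Morita context. -/
theorem exists_moritaContext (hP : P.IsProgenerator) :
    ∃ M : MoritaContext k R S, M.P = P := by
  obtain ⟨g, hg⟩ := hP.exists_pairing
  have f_smul : ∀ (p : P) (q : P.dual) (p' : P), P.evalBilin p q • p' = op (g q p') • p :=
    fun p q p' => (hg q p' p).symm
  have g_smul : ∀ (q : P.dual) (p : P) (q' : P.dual), g q p • q' = op (P.evalBilin p q') • q :=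
    fun q p q' => P.dualEquiv.injective <| LinearMap.ext fun p' => by
      simp only [dualEquiv_smul, hg, map_smul, dualEquiv_op_smul, evalBilin_apply, smul_eq_mul]
  have g_smul_left : ∀ (r : R) (q : P.dual) (p : P), g (r • q) p = r * g q p :=
    fun r q p => hP.eq_of_op_smul_eq fun p' => by rw [op_mul, mul_smul, hg, hg, dualEquiv_smul]
  have g_op_smul_left : ∀ (s : S) (q : P.dual) (p : P), g (op s • q) p = g q (s • p) :=
    fun s q p => hP.eq_of_op_smul_eq fun p' => by rw [hg, hg, dualEquiv_op_smul, mul_smul]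
  have g_op_smul_right : ∀ (q : P.dual) (p : P) (r : R), g q (op r • p) = g q p * r :=
    fun q p r => hP.eq_of_op_smul_eq fun p' => by rw [op_mul, mul_smul, hg, hg, smul_comm]
  obtain ⟨f', hf'⟩ := exists_balEquiv P.evalBilin g (fun s p q => by simp)
    (fun r p q => by simp) f_smul g_smul hP.generator
  obtain ⟨g', hg'⟩ := exists_balEquiv g P.evalBilin g_smul_left g_op_smul_left g_smul f_smul (by
    obtain ⟨n, φ, x, h⟩ := hP.dual_basis
    refine ⟨n, fun i => P.dualEquiv.symm (φ i), x, hP.eq_of_op_smul_eq fun p => ?_⟩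
    rw [Finset.op_sum, Finset.sum_smul, op_one, one_smul]
    simpa [hg] using h p)
  exact ⟨{ P := P
           Q := P.dual
           f := f'
           f_op_smul := fun p q s => by simp [hf']
           g := g'
           g_op_smul := fun q p r => by rw [hg', hg', g_op_smul_right]
           f_smul := fun p q p' => by rw [hf', hg', f_smul]
           g_smul := fun q p q' => by rw [hf', hg', g_smul] }, rfl⟩

end IsProgenerator

end FDBimod

/-! ### The bimodule of a linear functor -/

section RegBimod

variable {k R S : Type u} [Field k] [Ring R] [Ring S] [Algebra k R] [Algebra k S]
  [FiniteDimensional k R] (F : FDMod k R ⥤ FDMod k S) [F.Additive] [F.Linear k]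

/-- The right action of `R` on `F R`, by functoriality. -/
abbrev regRightModule : Module Rᵐᵒᵖ (F.obj (regObj k R)) where
  smul r p := FDMod.lin (F.map (eltHom (regEquiv k R r.unop))) p
  one_smul p := by
    change FDMod.lin (F.map (eltHom (regEquiv k R 1))) p = p
    rw [show eltHom (regEquiv k R 1) = 𝟙 _ from reg_ext (by simp), F.map_id, FDMod.lin_id,
      LinearMap.id_apply]
  mul_smul r r' p := by
    change FDMod.lin (F.map (eltHom (regEquiv k R (r'.unop * r.unop)))) p =
      FDMod.lin (F.map _) (FDMod.lin (F.map _) p)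
    rw [← LinearMap.comp_apply, ← FDMod.lin_comp, ← F.map_comp, eltHom_comp, lin_eltHom,
      smul_regEquiv]
  smul_zero r := map_zero (FDMod.lin (F.map (eltHom (regEquiv k R r.unop))))
  smul_add r := map_add (FDMod.lin (F.map (eltHom (regEquiv k R r.unop))))
  add_smul r r' p := by
    change FDMod.lin (F.map (eltHom (regEquiv k R (r.unop + r'.unop)))) p =
      FDMod.lin (F.map _) p + FDMod.lin (F.map _) p
    rw [map_add, eltHom_add, F.map_add, FDMod.lin_add, LinearMap.add_apply]
  zero_smul p := by
    change FDMod.lin (F.map (eltHom (regEquiv k R 0))) p = 0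
    rw [map_zero, eltHom_zero, F.map_zero]
    rfl

/-- The `(S, R)`-bimodule `F R`. -/
def regBimod : FDBimod k S R :=
  letI := regRightModule F
  { carrier := F.obj (regObj k R)
    rightTower := ⟨fun c r p => by
      change FDMod.lin (F.map (eltHom (regEquiv k R (c • r.unop)))) p =
        c • FDMod.lin (F.map (eltHom (regEquiv k R r.unop))) p
      rw [map_smul, eltHom_smul, F.map_smul, FDMod.lin_smul, LinearMap.smul_apply]⟩
    smulComm := ⟨fun s r p =>
      ((FDMod.lin (F.map (eltHom (regEquiv k R r.unop)))).map_smul s p).symm⟩ }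

/-- The identification of the underlying space of `regBimod F` with `F R`. -/
def toRegBimod : F.obj (regObj k R) ≃ₗ[k] regBimod F := LinearEquiv.refl k _

theorem smul_toRegBimod (s : S) (p : F.obj (regObj k R)) :
    s • toRegBimod F p = toRegBimod F (s • p) := rfl

theorem op_smul_toRegBimod (r : R) (p : F.obj (regObj k R)) :
    op r • toRegBimod F p =
      toRegBimod F (FDMod.lin (F.map (eltHom (regEquiv k R r))) p) := rfl

/-- The bilinear map `(p, v) ↦ F (eltHom v) p`, which induces `F R ⊗_R V ⟶ F V`. -/
def evalElt (V : FDMod k R) : regBimod F →ₗ[k] V →ₗ[k] F.obj V :=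
  LinearMap.mk₂ k (fun p v => FDMod.lin (F.map (eltHom v)) ((toRegBimod F).symm p))
    (fun p p' v => by simp) (fun c p v => by simp [LinearMap.map_smul_of_tower])
    (fun p v v' => by simp [eltHom_add])
    (fun c p v => by simp [eltHom_smul])

variable {F}

@[simp]
theorem evalElt_toRegBimod {V : FDMod k R} (p : F.obj (regObj k R)) (v : V) :
    evalElt F V (toRegBimod F p) v = FDMod.lin (F.map (eltHom v)) p := rfl

theorem evalElt_smul {V : FDMod k R} (s : S) (p : regBimod F) (v : V) :
    evalElt F V (s • p) v = s • evalElt F V p v :=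
  (FDMod.lin (F.map (eltHom v))).map_smul s ((toRegBimod F).symm p)

theorem evalElt_op_smul {V : FDMod k R} (p : regBimod F) (r : R) (v : V) :
    evalElt F V (op r • p) v = evalElt F V p (r • v) := by
  obtain ⟨p, rfl⟩ := (toRegBimod F).surjective p
  rw [op_smul_toRegBimod, evalElt_toRegBimod, evalElt_toRegBimod, ← LinearMap.comp_apply,
    ← FDMod.lin_comp, ← F.map_comp, eltHom_comp, lin_eltHom]

theorem lin_map_evalElt {V W : FDMod k R} (f : V ⟶ W) (p : regBimod F) (v : V) :
    FDMod.lin (F.map f) (evalElt F V p v) = evalElt F W p (FDMod.lin f v) := by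
  obtain ⟨p, rfl⟩ := (toRegBimod F).surjective p
  rw [evalElt_toRegBimod, evalElt_toRegBimod, ← LinearMap.comp_apply, ← FDMod.lin_comp,
    ← F.map_comp, eltHom_comp]

theorem eq_zero_of_evalElt [F.Faithful] {V : FDMod k R} {v : V}
    (h : ∀ p, evalElt F V p v = 0) : v = 0 := by
  refine eltHom_injective (F.map_injective (FDMod.hom_ext fun p => ?_))
  refine (h (toRegBimod F p)).trans ?_
  rw [eltHom_zero, F.map_zero]
  rfl

/-- For `F V ⟶ S` and `v : V`, the functional `p ↦ i (F (eltHom v) p)` on `F R`. -/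
def evalFunctional [FiniteDimensional k S] {V : FDMod k R} (i : F.obj V ⟶ regObj k S) (v : V) :
    regBimod F →ₗ[S] S where
  toFun p := (regEquiv k S).symm (FDMod.lin i (evalElt F V p v))
  map_add' p p' := by simp
  map_smul' s p := by
    rw [evalElt_smul, map_smul]
    rfl

theorem regEquiv_evalFunctional [FiniteDimensional k S] {V : FDMod k R}
    (i : F.obj V ⟶ regObj k S) (v : V) (p : regBimod F) :
    regEquiv k S (evalFunctional i v p) = FDMod.lin i (evalElt F V p v) :=
  (regEquiv k S).apply_symm_apply _

end RegBimod

/-! ### Equivalences and progenerators -/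

section Equivalence

/-- The quotient of a module by a submodule. -/
def FDMod.quot {k A : Type u} [Field k] [Ring A] [Algebra k A] {V : FDMod k A}
    (T : Submodule A V) : FDMod k A where
  carrier := V ⧸ T

/-- The quotient map. -/
def FDMod.mkQ {k A : Type u} [Field k] [Ring A] [Algebra k A] {V : FDMod k A}
    (T : Submodule A V) : V ⟶ FDMod.quot T := FDMod.ofLin T.mkQ

theorem FDMod.eq_top_of_mkQ {k A : Type u} [Field k] [Ring A] [Algebra k A] {V : FDMod k A}
    {T : Submodule A V} (h : ∀ v, FDMod.lin (FDMod.mkQ T) v = 0) : T = ⊤ :=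
  Submodule.eq_top_iff'.2 fun v => (Submodule.Quotient.mk_eq_zero T).1 (h v)

variable {k R S : Type u} [Field k] [Ring R] [Ring S] [Algebra k R] [Algebra k S]
  [FiniteDimensional k R] (F : FDMod k R ⥤ FDMod k S) [F.Additive]
  [F.IsEquivalence]

/-- If `F W ≅ S`, then the images of the morphisms `W ⟶ R` generate `R`: a morphism out of `R` that
vanishes on them is sent by `F` to one that vanishes on all images of `S`, hence to zero. -/
theorem span_hom_reg [FiniteDimensional k S] {W : FDMod k R} (i : F.obj W ≅ regObj k S) :
    Submodule.span R {x | ∃ (ψ : W ⟶ regObj k R) (w : W), x = FDMod.lin ψ w} = ⊤ := by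
  refine FDMod.eq_top_of_mkQ fun r => ?_
  generalize hT : Submodule.span R {x | ∃ (ψ : W ⟶ regObj k R) (w : W), x = FDMod.lin ψ w} = T
  have h0 : F.map (FDMod.mkQ T) = 0 := FDMod.hom_ext fun x => by
    have h1 : F.preimage (i.hom ≫ eltHom x) ≫ FDMod.mkQ T = 0 := FDMod.hom_ext fun w =>
      (Submodule.Quotient.mk_eq_zero T).2 (hT ▸ Submodule.subset_span ⟨_, w, rfl⟩)
    have h2 : eltHom x ≫ F.map (FDMod.mkQ T) = 0 := by
      rw [← cancel_epi i.hom, ← Category.assoc, ← F.map_preimage (i.hom ≫ eltHom x),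
        ← F.map_comp, h1, F.map_zero, Limits.comp_zero]
    have h3 := congrArg (fun f => FDMod.lin f (regEquiv k S 1)) h2
    simp only [FDMod.lin_comp, LinearMap.comp_apply, lin_eltHom, one_smul] at h3
    exact h3
  rw [show FDMod.mkQ T = 0 from F.map_injective (h0.trans (F.map_zero _ _).symm)]
  rfl

variable [F.Linear k]

/-- For an equivalence `F`, the module `F V` is generated by the images of `F R`: the quotient by
the submodule they generate is, up to isomorphism, the image of a quotient of `V` in which all
elements of `V` vanish. -/
theorem span_evalElt (V : FDMod k R) :
    Submodule.span S {x | ∃ p v, x = evalElt F V p v} = ⊤ := by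
  refine FDMod.eq_top_of_mkQ fun w => ?_
  generalize hT : Submodule.span S {x | ∃ p v, x = evalElt F V p v} = T
  let i := F.objObjPreimageIso (FDMod.quot T)
  let π : V ⟶ F.objPreimage (FDMod.quot T) := F.preimage (FDMod.mkQ T ≫ i.inv)
  have hπ : F.map π = FDMod.mkQ T ≫ i.inv := F.map_preimage _
  have h0 : π = 0 := FDMod.hom_ext fun v => eq_zero_of_evalElt (F := F) fun p => by
    rw [← lin_map_evalElt, hπ, FDMod.lin_comp, LinearMap.comp_apply]
    have : FDMod.lin (FDMod.mkQ T) (evalElt F V p v) = 0 :=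
      (Submodule.Quotient.mk_eq_zero T).2 (hT ▸ Submodule.subset_span ⟨p, v, rfl⟩)
    rw [this, map_zero]
  have h1 : FDMod.mkQ T = 0 := by
    rw [← cancel_mono i.inv, ← hπ, h0, F.map_zero, Limits.zero_comp]
  rw [h1]
  rfl

theorem isProgenerator_regBimod [FiniteDimensional k S] : (regBimod F).IsProgenerator where
  exists_eq_op_smul e := by
    let e' : F.obj (regObj k R) ⟶ F.obj (regObj k R) := FDMod.ofLin
      { toFun := fun p => (toRegBimod F).symm (e (toRegBimod F p))
        map_add' := fun p p' => by simp
        map_smul' := fun s p => e.map_smul s (toRegBimod F p) }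
    refine ⟨(regEquiv k R).symm (FDMod.lin (F.preimage e') (regEquiv k R 1)), fun p => ?_⟩
    obtain ⟨p, rfl⟩ := (toRegBimod F).surjective p
    rw [op_smul_toRegBimod, LinearEquiv.apply_symm_apply, eltHom_lin, F.map_preimage]
    exact (toRegBimod F).apply_symm_apply _
  eq_zero r h := by
    refine (regEquiv k R).injective (eltHom_injective (F.map_injective (FDMod.hom_ext fun p => ?_)))
    refine (h (toRegBimod F p)).trans ?_
    rw [map_zero, eltHom_zero, F.map_zero]
    rfl
  generator := by
    -- Write the unit of `S ≅ F V` as a sum of elements of the form `s • F (eltHom v) p`.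
    let V := F.objPreimage (regObj k S)
    let i : F.obj V ≅ regObj k S := F.objObjPreimageIso _
    have h1 : FDMod.lin i.inv (regEquiv k S 1) ∈
        Submodule.span S {x | ∃ p v, x = evalElt F V p v} := by
      rw [span_evalElt]; trivial
    obtain ⟨n, a, x, hx⟩ := Submodule.mem_span_set'.1 h1
    choose p v hpv using fun j => (x j).2
    refine ⟨n, fun j => a j • p j, fun j => evalFunctional i.hom (v j), (regEquiv k S).injective ?_⟩
    have h2 : ∀ j, regEquiv k S (evalFunctional i.hom (v j) (a j • p j)) =
        FDMod.lin i.hom (a j • (x j : F.obj V)) := fun j => by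
      rw [regEquiv_evalFunctional, evalElt_smul, hpv]
    rw [map_sum, Finset.sum_congr rfl fun j _ => h2 j, ← map_sum, hx, ← LinearMap.comp_apply,
      ← FDMod.lin_comp, i.inv_hom_id, FDMod.lin_id, LinearMap.id_apply]
  dual_basis := by
    let W := F.objPreimage (regObj k S)
    let i : F.obj W ≅ regObj k S := F.objObjPreimageIso _
    have h1 : regEquiv k R 1 ∈
        Submodule.span R {x | ∃ (ψ : W ⟶ regObj k R) (w : W), x = FDMod.lin ψ w} := by
      rw [span_hom_reg F i]; trivial
    obtain ⟨n, a, x, hx⟩ := Submodule.mem_span_set'.1 h1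
    choose ψ w hψ using fun j => (x j).2
    -- The identity of `R` is a sum of morphisms that factor through `W`; apply `F` to it.
    have h2 : ∑ j, eltHom (a j • w j) ≫ ψ j = 𝟙 (regObj k R) := by
      have h3 : ∀ j, eltHom (a j • w j) ≫ ψ j = eltHom (a j • (x j : regObj k R)) := fun j => by
        rw [eltHom_comp, map_smul, hψ]
      simp only [h3]
      rw [← eltHom_sum, hx]
      exact reg_ext (by simp)
    refine ⟨n, fun j => evalFunctional i.hom (a j • w j), fun j => toRegBimod F
      (FDMod.lin (F.map (ψ j)) (FDMod.lin i.inv (regEquiv k S 1))), fun p => ?_⟩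
    obtain ⟨p, rfl⟩ := (toRegBimod F).surjective p
    have h5 : ∀ j, evalFunctional i.hom (a j • w j) (toRegBimod F p) •
        toRegBimod F (FDMod.lin (F.map (ψ j)) (FDMod.lin i.inv (regEquiv k S 1))) =
        toRegBimod F (FDMod.lin (F.map (eltHom (a j • w j) ≫ ψ j)) p) := fun j => by
      rw [smul_toRegBimod, ← map_smul, ← map_smul, smul_regEquiv, mul_one,
        regEquiv_evalFunctional, ← LinearMap.comp_apply (FDMod.lin i.inv), ← FDMod.lin_comp,
        i.hom_inv_id, FDMod.lin_id, LinearMap.id_apply, evalElt_toRegBimod, F.map_comp,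
        FDMod.lin_comp, LinearMap.comp_apply]
    simp only [h5]
    rw [← map_sum, ← LinearMap.sum_apply, ← FDMod.lin_sum, ← F.map_sum, h2, F.map_id,
      FDMod.lin_id, LinearMap.id_apply]

end Equivalence

/-! ### The coaction on the bimodule of a module functor -/

section Coaction

open MonoidalLeftAction CategoryTheory.Functor.OplaxLeftLinear

variable {k H R S : Type u} [Field k] [Ring H] [Ring R] [Ring S] [Bialgebra k H]
  [Algebra k R] [Algebra k S] [LeftComoduleAlgebra k H R] [LeftComoduleAlgebra k H S]
  (F : OplaxModuleFunctor k (FDMod k H) (FDMod k R) (FDMod k S))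

/-- The transformation `F (X ⊗ V) ⟶ X ⊗ F V` of an oplax module functor. -/
def oplaxator (X : FDMod k H) (V : FDMod k R) :
    F.functor.obj (actObj X V) ⟶ actObj X (F.functor.obj V) :=
  δₗ F.functor X V

theorem oplaxator_naturality {X X' : FDMod k H} {V V' : FDMod k R} (f : X ⟶ X') (g : V ⟶ V') :
    F.functor.map (actMap f g) ≫ oplaxator F X' V' =
      oplaxator F X V ≫ actMap f (F.functor.map g) := by
  have h1 : F.functor.map (actMap f (𝟙 V)) ≫ oplaxator F X' V =
      oplaxator F X V ≫ actMap f (𝟙 _) :=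
    δₗ_naturality_left (F := F.functor) f V
  have h2 : F.functor.map (actMap (𝟙 X') g) ≫ oplaxator F X' V' =
      oplaxator F X' V ≫ actMap (𝟙 X') (F.functor.map g) :=
    δₗ_naturality_right (F := F.functor) X' g
  have h3 : actMap f g = actMap f (𝟙 V) ≫ actMap (𝟙 X') g := act_ext fun x v => by simp
  have h4 : actMap f (F.functor.map g) = actMap f (𝟙 _) ≫ actMap (𝟙 X') (F.functor.map g) :=
    act_ext fun x v => by simp
  rw [h3, h4, F.functor.map_comp, Category.assoc, h2, ← Category.assoc, h1, Category.assoc]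

variable [FiniteDimensional k H] [FiniteDimensional k R]

/-- The morphism `F R ⟶ H ⊗ F R`, the image under `F` of the coaction of `R` followed by the
transformation `F (H ⊗ R) ⟶ H ⊗ F R`. -/
def regCoactHom : F.functor.obj (regObj k R) ⟶
    actObj (regObj k H) (F.functor.obj (regObj k R)) :=
  F.functor.map (eltHom (actEquiv (regObj k H) (regObj k R) (regEquiv k H 1 ⊗ₜ regEquiv k R 1))) ≫
    oplaxator F _ _

/-- By naturality, the transformation `F (X ⊗ V) ⟶ X ⊗ F V` is determined by `regCoactHom`. -/
theorem map_eltHom_comp_oplaxator {X : FDMod k H} {V : FDMod k R} (x : X) (v : V) :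
    F.functor.map (eltHom (actEquiv X V (x ⊗ₜ v))) ≫ oplaxator F X V =
      regCoactHom F ≫ actMap (eltHom x) (F.functor.map (eltHom v)) := by
  rw [regCoactHom, Category.assoc, ← oplaxator_naturality, ← Category.assoc, ← F.functor.map_comp,
    eltHom_comp, lin_actMap, lin_eltHom, lin_eltHom, one_smul, one_smul]

/-- The identification of `H ⊗ F R` with the underlying space of the module `H ⊗ F R`. -/
def regTensorEquiv : H ⊗[k] regBimod F.functor ≃ₗ[k]
    actObj (regObj k H) (F.functor.obj (regObj k R)) :=
  (TensorProduct.congr (regEquiv k H) (toRegBimod F.functor).symm).trans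
    (actEquiv (regObj k H) (F.functor.obj (regObj k R)))

/-- The coaction on `F R`. -/
def regCoaction : regBimod F.functor →ₗ[k] H ⊗[k] regBimod F.functor :=
  (regTensorEquiv F).symm.toLinearMap ∘ₗ
    FDMod.klin (regCoactHom F) ∘ₗ (toRegBimod F.functor).symm.toLinearMap

variable {F}

theorem regTensorEquiv_tmul (h : H) (p : F.functor.obj (regObj k R)) :
    regTensorEquiv F (h ⊗ₜ toRegBimod F.functor p) = actEquiv _ _ (regEquiv k H h ⊗ₜ p) := rfl

theorem regTensorEquiv_regCoaction (p : F.functor.obj (regObj k R)) :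
    regTensorEquiv F (regCoaction F (toRegBimod F.functor p)) = FDMod.lin (regCoactHom F) p := by
  simp [regCoaction]

/-- The identification of `H ⊗ (H ⊗ F R)` with the underlying space of a module. -/
def regTensorEquiv₂ : H ⊗[k] (H ⊗[k] regBimod F.functor) ≃ₗ[k]
    actObj (regObj k H) (actObj (regObj k H) (F.functor.obj (regObj k R))) :=
  (TensorProduct.congr (regEquiv k H) (regTensorEquiv F)).trans (actEquiv _ _)

theorem regTensorEquiv₂_lTensor (z : H ⊗[k] regBimod F.functor) :
    regTensorEquiv₂ ((regCoaction F).lTensor H z) =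
      FDMod.lin (actMap (𝟙 (regObj k H)) (regCoactHom F)) (regTensorEquiv F z) := by
  induction z with
  | zero => simp
  | add a b ha hb => simp only [map_add, ha, hb]
  | tmul h p =>
    obtain ⟨p, rfl⟩ := (toRegBimod F.functor).surjective p
    simp [regTensorEquiv₂, regTensorEquiv_tmul, regTensorEquiv_regCoaction]

/-- The comultiplication as a morphism of `H`-modules. -/
def comulHom (k H : Type u) [Field k] [Ring H] [Bialgebra k H] [FiniteDimensional k H] :
    regObj k H ⟶ actObj (regObj k H) (regObj k H) :=
  eltHom (actEquiv _ _ (regEquiv k H 1 ⊗ₜ regEquiv k H 1))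

theorem lin_comulHom (h : H) : FDMod.lin (comulHom k H) (regEquiv k H h) =
    actEquiv _ _ (TensorProduct.congr (regEquiv k H) (regEquiv k H)
      (Coalgebra.comul (R := k) h)) := by
  rw [comulHom, lin_eltHom, smul_actEquiv]
  congr 1
  change tensorAct k H H _ _ (Coalgebra.comul (R := k) h) _ = _
  induction Coalgebra.comul (R := k) h with
  | zero => simp
  | add a b ha hb => simp only [map_add, LinearMap.add_apply, ha, hb]
  | tmul a b => simp [smul_regEquiv]

theorem regTensorEquiv₂_comul (z : H ⊗[k] regBimod F.functor) :
    regTensorEquiv₂ (TensorProduct.assoc k H H _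
        ((Coalgebra.comul (R := k) (A := H)).rTensor _ z)) =
      FDMod.lin (actMap (comulHom k H) (𝟙 _) ≫ (actAssoc _ _ _).hom) (regTensorEquiv F z) := by
  induction z with
  | zero => simp
  | add a b ha hb => simp only [map_add, ha, hb]
  | tmul h p =>
    obtain ⟨p, rfl⟩ := (toRegBimod F.functor).surjective p
    rw [regTensorEquiv_tmul, FDMod.lin_comp, LinearMap.comp_apply, lin_actMap, lin_comulHom,
      LinearMap.rTensor_tmul]
    induction Coalgebra.comul (R := k) h with
    | zero => simp
    | add a b ha hb => simp only [map_add, TensorProduct.add_tmul, ha, hb]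
    | tmul a b => simp [regTensorEquiv₂, regTensorEquiv_tmul]

theorem regCoactHom_coassoc :
    regCoactHom F ≫ actMap (comulHom k H) (𝟙 _) ≫ (actAssoc _ _ _).hom =
      regCoactHom F ≫ actMap (𝟙 (regObj k H)) (regCoactHom F) := by
  have h1 := map_eltHom_comp_oplaxator F (X := actObj (regObj k H) (regObj k H))
    (actEquiv _ _ (regEquiv k H 1 ⊗ₜ regEquiv k H 1)) (regEquiv k R 1)
  have hid : ∀ {A : Type u} [Ring A] [Algebra k A] [FiniteDimensional k A],
      eltHom (regEquiv k A 1) = 𝟙 (regObj k A) := fun {A} _ _ _ => reg_ext (by simp)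
  rw [hid, F.functor.map_id] at h1
  have h2 : oplaxator F (actObj (regObj k H) (regObj k H)) (regObj k R) ≫ (actAssoc _ _ _).hom =
      F.functor.map (actAssoc _ _ _).hom ≫ oplaxator F (regObj k H) (actObj (regObj k H)
        (regObj k R)) ≫ actMap (𝟙 _) (oplaxator F (regObj k H) (regObj k R)) :=
    δₗ_associativity (F := F.functor) (regObj k H) (regObj k H) (regObj k R)
  have h3 := map_eltHom_comp_oplaxator F (X := regObj k H)
    (regEquiv k H 1) (actEquiv _ _ (regEquiv k H 1 ⊗ₜ regEquiv k R 1))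
  rw [hid] at h3
  have h4 : actMap (𝟙 (regObj k H)) (regCoactHom F) =
      actMap (𝟙 (regObj k H)) (F.functor.map (eltHom (actEquiv (regObj k H) (regObj k R)
        (regEquiv k H 1 ⊗ₜ regEquiv k R 1)))) ≫ actMap (𝟙 _) (oplaxator F _ _) :=
    act_ext fun x v => by simp [regCoactHom]
  rw [← Category.assoc, comulHom, ← h1, Category.assoc, h2, ← Category.assoc,
    ← F.functor.map_comp, eltHom_comp, lin_actAssoc_hom, ← Category.assoc, h3, Category.assoc, h4]

theorem regCoactHom_counit (p : F.functor.obj (regObj k R)) :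
    FDMod.lin (regCoactHom F ≫ actMap (eltHom (unitEquiv k H 1)) (𝟙 _) ≫ (actUnit _).hom) p =
      p := by
  have h1 := map_eltHom_comp_oplaxator F (unitEquiv k H 1) (regEquiv k R 1)
  rw [show eltHom (regEquiv k R 1) = 𝟙 (regObj k R) from reg_ext (by simp), F.functor.map_id] at h1
  have h2 : eltHom (actEquiv (unitObj k H) (regObj k R) (unitEquiv k H 1 ⊗ₜ regEquiv k R 1)) =
      (actUnit (H := H) (regObj k R)).inv := reg_ext (by rw [lin_eltHom, one_smul]; rfl)
  have h3 : (actUnit (H := H) (F.functor.obj (regObj k R))).inv =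
      F.functor.map (actUnit (H := H) (regObj k R)).inv ≫ oplaxator F (unitObj k H) (regObj k R) :=
    δₗ_unitality_inv (C := FDMod k H) (F := F.functor) (regObj k R)
  rw [← Category.assoc, ← h1, h2, ← h3, Iso.inv_hom_id]
  rfl

theorem lin_counit (z : H ⊗[k] regBimod F.functor) :
    FDMod.lin (actMap (eltHom (unitEquiv k H 1)) (𝟙 _) ≫ (actUnit _).hom) (regTensorEquiv F z) =
      (toRegBimod F.functor).symm (TensorProduct.lid k _
        ((Coalgebra.counit (R := k) (A := H)).rTensor _ z)) := by
  induction z with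
  | zero => simp
  | add a b ha hb => simp only [map_add, ha, hb]
  | tmul h p =>
    obtain ⟨p, rfl⟩ := (toRegBimod F.functor).surjective p
    simp [regTensorEquiv_tmul, smul_unitEquiv]

theorem regTensorEquiv_smul (x : H ⊗[k] S) (z : H ⊗[k] regBimod F.functor) :
    regTensorEquiv F (tensorBilin (LinearMap.mul k H)
        (Algebra.lsmul k k (regBimod F.functor)).toLinearMap x z) =
      actEquiv _ _ (tensorAct k H S _ _ x ((actEquiv _ _).symm (regTensorEquiv F z))) := by
  induction x with
  | zero => simp
  | add a b ha hb => simp only [map_add, LinearMap.add_apply, ha, hb]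
  | tmul a s =>
    induction z with
    | zero => simp
    | add a b ha hb => simp only [map_add, ha, hb]
    | tmul h p =>
      obtain ⟨p, rfl⟩ := (toRegBimod F.functor).surjective p
      simp [regTensorEquiv_tmul, smul_toRegBimod, smul_regEquiv]

theorem lin_actMap_regTensorEquiv (z : H ⊗[k] regBimod F.functor) (h : H) (r : R) :
    FDMod.lin (actMap (eltHom (regEquiv k H h)) (F.functor.map (eltHom (regEquiv k R r))))
        (regTensorEquiv F z) =
      regTensorEquiv F (tensorBilin (LinearMap.mul k H) (regBimod F.functor).rightAct z
        (h ⊗ₜ r)) := by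
  induction z with
  | zero => simp
  | add a b ha hb => simp only [map_add, LinearMap.add_apply, ha, hb]
  | tmul a p =>
    obtain ⟨p, rfl⟩ := (toRegBimod F.functor).surjective p
    simp [regTensorEquiv_tmul, op_smul_toRegBimod, smul_regEquiv]

theorem regCoaction_op_smul (u : H ⊗[k] R) (p : F.functor.obj (regObj k R)) :
    FDMod.lin (F.functor.map (eltHom (actEquiv _ _
        (TensorProduct.congr (regEquiv k H) (regEquiv k R) u))) ≫ oplaxator F _ _) p =
      regTensorEquiv F (tensorBilin (LinearMap.mul k H) (regBimod F.functor).rightAct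
        (regCoaction F (toRegBimod F.functor p)) u) := by
  induction u with
  | zero =>
    simp only [map_zero, eltHom_zero, F.functor.map_zero, Limits.zero_comp]
    rfl
  | add a b ha hb =>
    simp only [map_add, eltHom_add, F.functor.map_add, Preadditive.add_comp, FDMod.lin_add,
      LinearMap.add_apply, ha, hb]
  | tmul h r =>
    rw [TensorProduct.congr_tmul, map_eltHom_comp_oplaxator, ← lin_actMap_regTensorEquiv,
      regTensorEquiv_regCoaction, FDMod.lin_comp, LinearMap.comp_apply]

variable (F) in
theorem isEquivariant_regCoaction :
    IsEquivariantCoaction (regBimod F.functor) (regCoaction F) where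
  coassoc := by
    ext p
    obtain ⟨p, rfl⟩ := (toRegBimod F.functor).surjective p
    simp only [LinearMap.comp_apply, LinearEquiv.coe_coe]
    apply regTensorEquiv₂.injective
    rw [regTensorEquiv₂_comul, regTensorEquiv₂_lTensor, regTensorEquiv_regCoaction,
      ← LinearMap.comp_apply, ← FDMod.lin_comp, regCoactHom_coassoc, FDMod.lin_comp,
      LinearMap.comp_apply]
  counit_coact := by
    ext p
    obtain ⟨p, rfl⟩ := (toRegBimod F.functor).surjective p
    apply (toRegBimod F.functor).symm.injective
    simp only [LinearMap.comp_apply, LinearEquiv.coe_coe, LinearMap.id_apply]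
    rw [← lin_counit, regTensorEquiv_regCoaction, ← LinearMap.comp_apply, ← FDMod.lin_comp,
      regCoactHom_counit, LinearEquiv.symm_apply_apply]
  map_smul s p := by
    obtain ⟨p, rfl⟩ := (toRegBimod F.functor).surjective p
    apply (regTensorEquiv F).injective
    rw [smul_toRegBimod, regTensorEquiv_regCoaction, map_smul, regTensorEquiv_smul, ← smul_actEquiv,
      LinearEquiv.apply_symm_apply, regTensorEquiv_regCoaction]
  map_op_smul p r := by
    obtain ⟨p, rfl⟩ := (toRegBimod F.functor).surjective p
    apply (regTensorEquiv F).injective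
    rw [← regCoaction_op_smul, op_smul_toRegBimod, regTensorEquiv_regCoaction,
      ← LinearMap.comp_apply, ← FDMod.lin_comp, regCoactHom, ← Category.assoc,
      ← F.functor.map_comp, eltHom_comp, lin_eltHom, smul_actEquiv]
    congr 6
    induction coact k H R r with
    | zero => simp
    | add a b ha hb => simp only [map_add, LinearMap.add_apply, ha, hb]
    | tmul a b => simp [smul_regEquiv]

variable (F) in
/-- The equivariant bimodule `F R` of an oplax module functor `F`. -/
def regEquivBimod : EquivBimod k H S R where
  bimod := regBimod F.functor
  coaction := regCoaction F
  isEquivariant := isEquivariant_regCoaction F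

end Coaction

/-! ### Every equivalence comes from a Morita context -/

section Watts

open MonoidalLeftAction CategoryTheory.Functor.OplaxLeftLinear

variable {k H R S : Type u} [Field k] [Ring H] [Ring R] [Ring S] [Bialgebra k H]
  [Algebra k R] [Algebra k S] [LeftComoduleAlgebra k H R] [LeftComoduleAlgebra k H S]

theorem exists_equivMoritaContext [FiniteDimensional k S] (P : EquivBimod k H S R)
    (hP : P.bimod.IsProgenerator) : ∃ M : EquivMoritaContext k H R S, M.equivBimod = P := by
  obtain ⟨P, ρ, hρ⟩ := P
  obtain ⟨M, rfl⟩ := hP.exists_moritaContext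
  exact ⟨⟨M, ρ, hρ⟩, rfl⟩

variable [FiniteDimensional k H] [FiniteDimensional k R]
  (F : OplaxModuleFunctor k (FDMod k H) (FDMod k R) (FDMod k S))

/-- The class of `p ⊗ v` in `F R ⊗_R V`. -/
def regTmk (V : FDMod k R) :
    regBimod F.functor →ₗ[k] V →ₗ[k] (regEquivBimod F).tensorObj V := (regEquivBimod F).tmk V

theorem regTmk_op_smul {V : FDMod k R} (p : regBimod F.functor) (r : R) (v : V) :
    regTmk F V (op r • p) v = regTmk F V p (r • v) := (regEquivBimod F).tmk_smul p r v

theorem exists_sum_regTmk {V : FDMod k R} (z : (regEquivBimod F).tensorObj V) :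
    ∃ (n : ℕ) (p : Fin n → regBimod F.functor) (v : Fin n → V),
      z = ∑ i, regTmk F V (p i) (v i) := by
  obtain ⟨t, rfl⟩ := ((regEquivBimod F).bimod.balRel V).mkQ_surjective z
  obtain ⟨n, p, v, rfl⟩ := TensorProduct.exists_sum_tmul_eq t
  exact ⟨n, p, v, map_sum _ _ _⟩

/-- The morphism `F R ⊗_R V ⟶ F V`, `p ⊗ v ↦ F (eltHom v) p`. -/
def wattsHom (V : FDMod k R) : (regEquivBimod F).tensorObj V ⟶ F.functor.obj V :=
  (regEquivBimod F).tensorDesc (evalElt F.functor V) evalElt_op_smul evalElt_smul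

@[simp]
theorem lin_wattsHom (V : FDMod k R) (p : regBimod F.functor) (v : V) :
    FDMod.lin (wattsHom F V) (regTmk F V p v) = evalElt F.functor V p v := rfl

theorem wattsHom_naturality {V W : FDMod k R} (f : V ⟶ W) :
    (regEquivBimod F).tensorMap f ≫ wattsHom F W = wattsHom F V ≫ F.functor.map f :=
  (regEquivBimod F).tensorObj_ext fun p v => (lin_map_evalElt f p v).symm

theorem actMap_wattsHom_preLineator (X : FDMod k H) (V : FDMod k R) (x : X) (v : V)
    (z : H ⊗[k] regBimod F.functor) :
    FDMod.lin (actMap (𝟙 X) (wattsHom F V))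
        (actEquiv X _ ((regEquivBimod F).preLineator X V z (x ⊗ₜ v))) =
      FDMod.lin (actMap (eltHom x) (F.functor.map (eltHom v))) (regTensorEquiv F z) := by
  let L : H ⊗[k] regBimod F.functor →ₗ[k] X ⊗[k] V →ₗ[k]
      X ⊗[k] (regEquivBimod F).tensorObj V := (regEquivBimod F).preLineator X V
  have hL : ∀ h p, L (h ⊗ₜ p) (x ⊗ₜ v) = (h • x) ⊗ₜ regTmk F V p v := fun h p => rfl
  change FDMod.lin (actMap (𝟙 X) (wattsHom F V)) (actEquiv X _ (L z (x ⊗ₜ v))) = _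
  clear_value L
  induction z with
  | zero => simp
  | add a b ha hb => simp only [map_add, LinearMap.add_apply, ha, hb]
  | tmul h p =>
    obtain ⟨p, rfl⟩ := (toRegBimod F.functor).surjective p
    simp [hL, regTensorEquiv_tmul]

theorem wattsHom_comm (X : FDMod k H) (V : FDMod k R) :
    wattsHom F (actObj X V) ≫ oplaxator F X V =
      (regEquivBimod F).lineator X V ≫ actMap (𝟙 X) (wattsHom F V) := by
  refine (regEquivBimod F).tensorObj_ext fun p w => ?_
  obtain ⟨t, rfl⟩ := (actEquiv X V).surjective w
  obtain ⟨p, rfl⟩ := (toRegBimod F.functor).surjective p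
  induction t with
  | zero => simp
  | add a b ha hb => simp only [map_add, ha, hb]
  | tmul x v =>
    have h1 := congrArg (fun f => FDMod.lin f p) (map_eltHom_comp_oplaxator F x v)
    simp only [FDMod.lin_comp, LinearMap.comp_apply, ← regTensorEquiv_regCoaction] at h1
    exact h1.trans (actMap_wattsHom_preLineator F X V x v _).symm

variable [F.functor.IsEquivalence]

theorem wattsHom_surjective (V : FDMod k R) : Function.Surjective (FDMod.lin (wattsHom F V)) := by
  refine LinearMap.range_eq_top.1 (top_le_iff.1 ?_)
  rw [← span_evalElt F.functor V, Submodule.span_le]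
  rintro _ ⟨p, v, rfl⟩
  exact ⟨regTmk F V p v, rfl⟩

variable [FiniteDimensional k S]

theorem wattsHom_injective (V : FDMod k R) : Function.Injective (FDMod.lin (wattsHom F V)) := by
  obtain ⟨g, hg⟩ := (isProgenerator_regBimod F.functor).exists_pairing
  obtain ⟨m, x, φ, hφ⟩ := (isProgenerator_regBimod F.functor).generator
  refine (injective_iff_map_eq_zero _).2 fun z hz => ?_
  obtain ⟨n, p, v, rfl⟩ := exists_sum_regTmk F z
  simp only [map_sum, lin_wattsHom] at hz
  -- With `1 = ∑ φᵢ(xᵢ)`, the element `∑ pₐ ⊗ vₐ` equals `∑ xᵢ ⊗ nᵢ` for `nᵢ = ∑ₐ g(φᵢ, pₐ) vₐ`, and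
  -- `F (eltHom nᵢ)` vanishes.
  let ψ (i : Fin m) : (regBimod F.functor).dual := (regBimod F.functor).dualEquiv.symm (φ i)
  have hn : ∀ i, ∑ a, g (ψ i) (p a) • v a = 0 := fun i =>
    eq_zero_of_evalElt (F := F.functor) fun q => by
      simp only [map_sum, ← evalElt_op_smul, hg, evalElt_smul]
      rw [← Finset.smul_sum, hz, smul_zero]
  have h1 : ∀ a, regTmk F V (p a) (v a) =
      ∑ i, regTmk F V (x i) (g (ψ i) (p a) • v a) := fun a => by
    have h2 : ∑ i, op (g (ψ i) (p a)) • x i = p a := by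
      simp only [hg, ψ, LinearEquiv.apply_symm_apply, ← Finset.sum_smul, hφ, one_smul]
    simp only [← regTmk_op_smul]
    rw [← LinearMap.sum_apply, ← map_sum, h2]
  rw [Finset.sum_congr rfl fun a _ => h1 a, Finset.sum_comm]
  refine Finset.sum_eq_zero fun i _ => ?_
  rw [← map_sum, hn, map_zero]

/-- The isomorphism `F R ⊗_R V ≅ F V` of module functors. -/
def wattsIso : (regEquivBimod F).moduleFunctor ≅ F :=
  let α : (regEquivBimod F).moduleFunctor ⟶ F :=
    { natTrans :=
        { app := wattsHom F
          naturality := fun _ _ f => wattsHom_naturality F f }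
      comm := fun X V => wattsHom_comm F X V }
  haveI : ∀ V, IsIso (α.natTrans.app V) := fun V =>
    FDMod.isIso_of_bijective (wattsHom F V) ⟨wattsHom_injective F V, wattsHom_surjective F V⟩
  OplaxModuleFunctor.isoOfComponents α

theorem exists_moduleFunctor_iso :
    ∃ M : EquivMoritaContext k H R S, Nonempty (M.moduleFunctor ≅ F) := by
  obtain ⟨M, hM⟩ := exists_equivMoritaContext (regEquivBimod F) (isProgenerator_regBimod F.functor)
  refine ⟨M, ?_⟩
  rw [EquivMoritaContext.moduleFunctor, hM]
  exact ⟨wattsIso F⟩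

end Watts

end

end HopfModCat

theorem mainTheorem9 (k H R S : Type u) [Field k] [IsAlgClosed k] [CharZero k]
    [Ring H] [HopfAlgebra k H] [FiniteDimensional k H]
    [Ring R] [Algebra k R] [FiniteDimensional k R] [LeftComoduleAlgebra k H R]
    [Ring S] [Algebra k S] [FiniteDimensional k S] [LeftComoduleAlgebra k H S] :
    (∃ e : Quotient (EquivMoritaContext.isoSetoid k H R S) ≃
        Quotient (isIsomorphicSetoid
          (ModuleEquivalence k (FDMod k H) (FDMod k R) (FDMod k S))),
      ∀ M : EquivMoritaContext k H R S, ∃ hM : M.moduleFunctor.IsModuleEquivalence,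
        e (Quotient.mk _ M) = Quotient.mk _ ⟨M.moduleFunctor, hM⟩) ∧
    (∀ M : EquivMoritaContext k H R S,
      ∃! ρ : M.Q →ₗ[k] H ⊗[k] M.Q, M.IsDualCoaction ρ) := by
  refine ⟨?_, fun M => M.existsUnique_isDualCoaction⟩
  let E (M : EquivMoritaContext k H R S) :
      ModuleEquivalence k (FDMod k H) (FDMod k R) (FDMod k S) :=
    ⟨M.moduleFunctor, M.isModuleEquivalence⟩
  let e : Quotient (EquivMoritaContext.isoSetoid k H R S) → Quotient (isIsomorphicSetoid
      (ModuleEquivalence k (FDMod k H) (FDMod k R) (FDMod k S))) :=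
    Quotient.map E fun M M' h =>
      ((EquivMoritaContext.isIsomorphic_iff M M').1 h).map fun α => ObjectProperty.isoMk _ α
  have he : Function.Bijective e := by
    constructor
    · rintro ⟨M⟩ ⟨M'⟩ h
      obtain ⟨α⟩ := Quotient.exact h
      exact Quotient.sound ((EquivMoritaContext.isIsomorphic_iff M M').2
        ⟨(ObjectProperty.ι _).mapIso α⟩)
    · rintro ⟨F⟩
      obtain ⟨-, G, -, ⟨a⟩, ⟨b⟩⟩ := F.property
      have := OplaxModuleFunctor.isEquivalence_functor a b
      obtain ⟨M, ⟨α⟩⟩ := exists_moduleFunctor_iso F.obj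
      exact ⟨Quotient.mk _ M, Quotient.sound ⟨ObjectProperty.isoMk _ α⟩⟩
  exact ⟨Equiv.ofBijective e he, fun M => ⟨M.isModuleEquivalence, rfl⟩⟩
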